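/- \textbf{Theorem (correctness of SaPHyRa$_{bc}$).} There is an absolute constant $c_0>0$ such that the following holds for every $c\ge c_0$. Let $G=(V,E)$ be a finite connected simple undirected graph with $n=|V|\ge 2$ nodes, $\emptyset\ne A\subseteq V$, and $\epsilon,\delta\in(0,1)$. Let $\sigma_{st}$ be the number of shortest $s$–$t$ paths, $\sigma_{st}(v)$ the number of those containing $v$, and $$bc(v)=\frac1{n(n-1)}\sum_{s\ne v\ne t}\frac{\sigma_{st}(v)}{\sigma_{st}}.$$ \emph{Bi-components.} Let $\mathbf C$ be the set of bi-components (maximal nonseparable subgraphs) of $G$, and $\mathbf C_A$ the set of those that meet $A$. For $v\in C\in\mathbf C$ let $R_C(v)$ be the set of nodes reachable from $v$ without going through another node of $C$, and put $r_C(v)=|R_C(v)|$, $T_C(v)=V\setminus R_C(v)$, $q_{st}=\frac{r_C(s)r_C(t)}{n(n-1)}$ for $s\ne t$ in $C$, $W_C=\sum_{s\in C}r_C(s)(n-r_C(s))$, $$\gamma=\frac{\sum_{C\in\mathbf C}W_C}{n(n-1)},\qquad \eta=\frac{\sum_{C\in\mathbf C_A}W_C}{\sum_{C\in\mathbf C}W_C},\qquad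 bc_a(v)=\frac1{n(n-1)}\sum_{C\ni v}|T_C(v)|\sum_{C'\ni v,\,C'\ne C}|T_{C'}(v)|.$$ \emph{Sample space.} Let $\mathcal X$ be the set of all shortest paths between two distinct nodes of a common $C\in\mathbf C_A$, let $\hat{\mathcal X}\subseteq\mathcal X$ be the set of the paths of length $2$ whose inner node lies in $A$, and $\tilde{\mathcal X}=\mathcal X\setminus\hat{\mathcal X}$. Let $g(v,p)=1$ if $v$ is an inner node of $p$, and $g(v,p)=0$ otherwise. Let $d\ge1$ be an integer that is at least the VC dimension of $\{g(v,\cdot)\}_{v\in A}$ on $\tilde{\mathcal X}$. \emph{Exact part.} Let $B$ be the set of neighbours of nodes of $A$, and $w_{st}$ the number of common neighbours of $s$ and $t$. For $v\in A$ let $$\hat\ell_v=\sum_{C\in\mathbf C}\ \sum_{s,t}\frac{q_{st}}{w_{st}\,\gamma\eta},$$ where the inner sum is over the ordered pairs of nodes $s,t\in B\cap C$ at distance $2$ that are both adjacent to $v$. Put $\hat\lambda=\sum_{v\in A}\hat\ell_v$, $\lambda=1-\hat\lambda$, $\epsilon^*=\epsilon/(\gamma\eta)$ and $\epsilon'=\epsilon^*/\lambda$.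 \emph{Sampler.} Repeat, independently, the following until a path $p\notin\hat{\mathcal X}$ is obtained, and return it: pick $C\in\mathbf C_A$ with probability $\frac{n^2-\sum_{s\in C}r_C(s)^2}{n(n-1)\gamma\eta}$, then $s\in C$ with probability $\frac{r_C(s)(n-r_C(s))}{n^2-\sum_{u\in C}r_C(u)^2}$, then $t\in C\setminus\{s\}$ with probability $\frac{r_C(t)}{n-r_C(s)}$, then a uniformly random shortest path $p$ from $s$ to $t$. \emph{Adaptive sampling.} Let $N_0=\frac{c}{\epsilon'^2}\ln\frac1\delta$, $N_{\max}=\frac{c}{\epsilon'^2}\left(d+\ln\frac1\delta\right)$ and $K=\lceil\log_2(N_{\max}/N_0)\rceil$; as sample sizes, $N_0$ and $N_{\max}$ are rounded up. From $N_0$ pilot samples choose, by any rule, numbers $\delta_v>0$ ($v\in A$) with $\sum_{v\in A}2\delta_v=\delta/K$. Let $x_1,x_2,\dots$ be further samples; all samples are independent outputs of the sampler. Start with $N=N_0$. In each of at most $K$ rounds, stop with the current $N$ if for every $v\in A$ $$\sqrt{\frac{2\,\mathrm{Var}_v\ln(2/\delta_v)}{N}}+\frac{7\ln(2/\delta_v)}{3N}\le\epsilon',\qquad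 \mathrm{Var}_v=\frac{1}{N(N-1)}\sum_{1\le i<j\le N}\bigl(g(v,x_i)-g(v,x_j)\bigr)^2$$ (with $\mathrm{Var}_v=0$ if $N=1$); otherwise replace $N$ by $\min(2N,N_{\max})$. With the final $N$ return $$\tilde{bc}(v)=bc_a(v)+\gamma\eta\,\ell_v,\qquad \ell_v=\hat\ell_v+\frac{\lambda}{N}\sum_{j=1}^N g(v,x_j)\qquad(v\in A).$$ Then the output probabilities of the sampler are nonnegative and sum to $1$, and $$\Pr\bigl[\forall v\in A:\ |\tilde{bc}(v)-bc(v)|<\epsilon\bigr]\ge 1-\delta .$$ -/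

import Mathlib

namespace SaPHyRa

noncomputable section

open scoped Classical

/-! ### The adaptive sampling framework -/

/-- Sample variance `1/(N(N-1)) ∑_{j₁<j₂} (z_{j₁} - z_{j₂})²` of the first `N` terms. -/
def sampleVar (N : ℕ) (z : ℕ → ℝ) : ℝ :=
  1 / ((N : ℝ) * ((N : ℝ) - 1)) *
    ∑ j₂ ∈ Finset.range N, ∑ j₁ ∈ Finset.range j₂, (z j₁ - z j₂) ^ 2

/-- The empirical Bernstein error `ε(N, δ₀, Var)`. -/
def bernsteinError (N : ℕ) (δ₀ var : ℝ) : ℝ :=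
  √(1 / (N : ℝ) * (2 * var * Real.log (2 / δ₀))) + 7 * Real.log (2 / δ₀) / (3 * (N : ℝ))

/-- The real number `N₀ = c / ε'² · ln (1/δ)`. -/
def initBudget (c ε' δ : ℝ) : ℝ := c / ε' ^ 2 * Real.log (1 / δ)

/-- The real number `N_max = c / ε'² · (d + ln (1/δ))`, `d` a bound on the VC dimension. -/
def maxBudget (c ε' δ : ℝ) (d : ℕ) : ℝ := c / ε' ^ 2 * ((d : ℝ) + Real.log (1 / δ))

/-- The initial number of samples. -/
def initSize (c ε' δ : ℝ) : ℕ := ⌈initBudget c ε' δ⌉₊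

/-- The maximum number of samples. -/
def maxSize (c ε' δ : ℝ) (d : ℕ) : ℕ := ⌈maxBudget c ε' δ d⌉₊

/-- The number of rounds `⌈log₂ (N_max / N₀)⌉`. -/
def rounds (c ε' δ : ℝ) (d : ℕ) : ℕ :=
  ⌈Real.logb 2 (maxBudget c ε' δ d / initBudget c ε' δ)⌉₊

/-- The loop of the framework: with `k` rounds left and current sample size `N`, keep `N` if the
stopping test succeeds, and otherwise replace `N` by `min (2N) N_max`. The value is the sample
size from which the final averages are computed; if no test succeeds it is `N_max`, and the samples
that are still missing are drawn before averaging. -/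
def finalSize (halt : ℕ → Prop) (Nmax : ℕ) : ℕ → ℕ → ℕ
  | 0, N => N
  | k + 1, N => if halt N then N else finalSize halt Nmax k (min (2 * N) Nmax)

/-- The number of samples used by the framework on the sample stream `x`, where `loss i y` is the
loss of hypothesis `i` on the sample `y` and `δs i` is the error probability allocated to `i`. -/
def frameworkSize {ι X : Type*} (loss : ι → X → ℝ) (c ε' δ : ℝ) (d : ℕ) (δs : ι → ℝ)
    (x : ℕ → X) : ℕ :=
  finalSize
    (fun N => ∀ i, bernsteinError N (δs i) (sampleVar N fun j => loss i (x j)) ≤ ε')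
    (maxSize c ε' δ d) (rounds c ε' δ d) (initSize c ε' δ)

/-- Output `ℓ_i = ℓ̂_i + λ ℓ̃_i` of the framework, given the output `(λ̂, ℓ̂)` of the exact
algorithm, with `λ = 1 - λ̂` and `ε' = ε / λ`. -/
def framework {ι X : Type*} (loss : ι → X → ℝ) (lamHat : ℝ) (exactRisk : ι → ℝ)
    (c ε δ : ℝ) (d : ℕ) (δs : ι → ℝ) (x : ℕ → X) (i : ι) : ℝ :=
  let lam := 1 - lamHat
  let N := frameworkSize loss c (ε / lam) δ d δs x
  exactRisk i + lam * (1 / (N : ℝ) * ∑ j ∈ Finset.range N, loss i (x j))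

/-- A rule that chooses, from the pilot samples, positive error probabilities `δ_i` with
`∑ 2 δ_i = δ / (number of rounds)`. -/
def IsErrorAllocation {ι Y : Type*} [Fintype ι] (alloc : Y → ι → ℝ) (c ε' δ : ℝ) (d : ℕ) :
    Prop :=
  ∀ y, (∀ i, 0 < alloc y i) ∧ ∑ i, 2 * alloc y i = δ / (rounds c ε' δ d : ℝ)

/-! ### Shortest paths and betweenness centrality -/

variable {V : Type*}

/-- A shortest path of `G` together with its end points. -/
structure ShortestPath (G : SimpleGraph V) where
  src : V
  tgt : V
  walk : G.Walk src tgt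
  isShortest : walk.length = G.dist src tgt

instance (G : SimpleGraph V) : MeasurableSpace (ShortestPath G) := ⊤

theorem ShortestPath.support_injective (G : SimpleGraph V) :
    Function.Injective fun p : ShortestPath G => p.walk.support := by
  rintro ⟨s, t, p, hp⟩ ⟨s', t', q, hq⟩ h
  have h' : p.support = q.support := h
  have hs : s = s' := by
    have := congrArg List.head? h'
    rw [List.head?_eq_some_head p.support_ne_nil, List.head?_eq_some_head q.support_ne_nil,
      p.head_support, q.head_support] at this
    exact Option.some.inj this
  have ht : t = t' := by
    have := congrArg List.getLast? h'
    rw [List.getLast?_eq_some_getLast p.support_ne_nil,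
      List.getLast?_eq_some_getLast q.support_ne_nil,
      p.getLast_support, q.getLast_support] at this
    exact Option.some.inj this
  subst hs ht
  have : p = q := SimpleGraph.Walk.ext_support h'
  subst this
  rfl

instance [Fintype V] (G : SimpleGraph V) : Fintype (ShortestPath G) := by
  have : Finite (ShortestPath G) :=
    Finite.of_injective
      (fun p : ShortestPath G => (⟨p.walk.support,
        (p.walk.isPath_of_length_eq_dist p.isShortest).support_nodup⟩ : {l : List V // l.Nodup}))
      (fun p q h => ShortestPath.support_injective G (congrArg Subtype.val h))
  exact Fintype.ofFinite _

/-- `v` is an inner node of `p`. -/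
def IsInner {G : SimpleGraph V} (v : V) (p : ShortestPath G) : Prop :=
  v ∈ p.walk.support ∧ v ≠ p.src ∧ v ≠ p.tgt

/-- The indicator `g(v, p)`; it is also the 0-1 loss of the hypothesis `h_v = g(v, ·)` with
respect to the labelling that is constantly `0`. -/
def g {G : SimpleGraph V} (v : V) (p : ShortestPath G) : ℝ := if IsInner v p then 1 else 0

variable [Fintype V]

/-- `σ_{st}`, the number of shortest paths from `s` to `t`. -/
def sigma (G : SimpleGraph V) (s t : V) : ℕ :=
  (Finset.univ.filter fun p : ShortestPath G => p.src = s ∧ p.tgt = t).card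

/-- `σ_{st}(v)`, the number of shortest paths from `s` to `t` that `v` lies on. -/
def sigmaThrough (G : SimpleGraph V) (s t v : V) : ℕ :=
  (Finset.univ.filter fun p : ShortestPath G =>
    p.src = s ∧ p.tgt = t ∧ v ∈ p.walk.support).card

/-- `n(n-1)` as a real number. -/
def numPairs (V : Type*) [Fintype V] : ℝ :=
  (Fintype.card V : ℝ) * ((Fintype.card V : ℝ) - 1)

/-- Betweenness centrality. -/
def bc (G : SimpleGraph V) (v : V) : ℝ :=
  1 / numPairs V *
    ∑ s ∈ Finset.univ.erase v, ∑ t ∈ Finset.univ.erase v,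
      (sigmaThrough G s t v : ℝ) / (sigma G s t : ℝ)

/-! ### Bi-components and out reach sets -/

/-- `C` spans a nonseparable subgraph: it is connected, and stays so if any node is removed. -/
def IsNonseparable (G : SimpleGraph V) (C : Finset V) : Prop :=
  (G.induce (C : Set V)).Connected ∧
    ∀ v ∈ C, (G.induce ((C : Set V) \ {v})).Preconnected

/-- The (node sets of the) bi-components, i.e. the maximal nonseparable subgraphs. -/
def bicomponents (G : SimpleGraph V) : Finset (Finset V) :=
  Finset.univ.filter fun C => Maximal (IsNonseparable G) C

/-- The bi-components that contain a target node. -/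
def targetBicomponents (G : SimpleGraph V) (A : Finset V) : Finset (Finset V) :=
  (bicomponents G).filter fun C => (C ∩ A).Nonempty

/-- The out reach set of `v ∈ C`: the nodes that can be reached from `v` without going through any
other node of `C`. -/
def outReach (G : SimpleGraph V) (C : Finset V) (v : V) : Finset V :=
  Finset.univ.filter fun u => ∃ p : G.Walk v u, ∀ w ∈ p.support, w ∈ C → w = v

/-- The size `r_C(v)` of the out reach set. -/
def r (G : SimpleGraph V) (C : Finset V) (v : V) : ℝ := ((outReach G C v).card : ℝ)

/-- `q_{st} = r_C(s) r_C(t) / (n(n-1))` for `s, t` in the bi-component `C`. -/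
def q (G : SimpleGraph V) (C : Finset V) (s t : V) : ℝ :=
  1 / numPairs V * (r G C s * r G C t)

/-- `∑_{s ∈ C} r_C(s) (n - r_C(s))`. -/
def bicomponentWeight (G : SimpleGraph V) (C : Finset V) : ℝ :=
  ∑ s ∈ C, r G C s * ((Fintype.card V : ℝ) - r G C s)

/-- The normalizing factor `γ`. -/
def gamma (G : SimpleGraph V) : ℝ :=
  1 / numPairs V * ∑ C ∈ bicomponents G, bicomponentWeight G C

/-- The factor `η`. -/
def eta (G : SimpleGraph V) (A : Finset V) : ℝ :=
  (∑ C ∈ targetBicomponents G A, bicomponentWeight G C) /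
    ∑ C ∈ bicomponents G, bicomponentWeight G C

/-- `|T_C(v)|`, where `T_C(v)` is the complement of the out reach set. -/
def tSize (G : SimpleGraph V) (C : Finset V) (v : V) : ℝ :=
  ((Finset.univ \ outReach G C v).card : ℝ)

/-- `bc_a(v)`, the contribution of the break points. -/
def bcA (G : SimpleGraph V) (v : V) : ℝ :=
  1 / numPairs V *
    ∑ C ∈ (bicomponents G).filter (fun C => v ∈ C),
      tSize G C v * ∑ C' ∈ ((bicomponents G).erase C).filter (fun C' => v ∈ C'), tSize G C' v

/-! ### Sample space -/

/-- The personalized intra-component sample space. -/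
def sampleSpace (G : SimpleGraph V) (A : Finset V) : Finset (ShortestPath G) :=
  Finset.univ.filter fun p =>
    p.src ≠ p.tgt ∧ ∃ C ∈ targetBicomponents G A, p.src ∈ C ∧ p.tgt ∈ C

/-- The exact subspace: paths of length two with a target node as inner node. -/
def exactSpace (G : SimpleGraph V) (A : Finset V) : Finset (ShortestPath G) :=
  (sampleSpace G A).filter fun p => p.walk.length = 2 ∧ ∃ v ∈ A, IsInner v p

/-- The approximate subspace. -/
def approxSpace (G : SimpleGraph V) (A : Finset V) : Finset (ShortestPath G) :=
  sampleSpace G A \ exactSpace G A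

/-- The hypotheses `h_v`, `v ∈ A`, as a family of subsets of the approximate subspace (the
space that is sampled); its VC dimension is at most the one over the whole sample space. -/
def hypothesisClass (G : SimpleGraph V) (A : Finset V) : Finset (Finset (ShortestPath G)) :=
  A.image fun v => (approxSpace G A).filter fun p => IsInner v p

/-! ### The exact algorithm -/

/-- The set `B` of all neighbours of target nodes. -/
def nbrsOfTargets (G : SimpleGraph V) (A : Finset V) : Finset V :=
  Finset.univ.filter fun u => ∃ v ∈ A, G.Adj v u

/-- First phase, the counter `w_t` for the source `s`: the number of `u` met by running through
the neighbours `u` of `s` and the neighbours of `u`, where `t` itself is met. -/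
def twoHopCount (G : SimpleGraph V) (s t : V) : ℕ :=
  (Finset.univ.filter fun u => G.Adj s u ∧ G.Adj u t).card

/-- First phase, the set `Δ_s` of the nodes at distance two from `s` (those met that are neither
`s` nor a neighbour of `s`). -/
def twoHopSet (G : SimpleGraph V) (s : V) : Finset V :=
  Finset.univ.filter fun t => t ≠ s ∧ ¬ G.Adj s t ∧ 0 < twoHopCount G s t

/-- Second phase, the number `ℓ̂_v`: every two-hop path `s, v, t` inside a bi-component
contributes `q_{st} / (w_t γ η)`. -/
def exactRisk (G : SimpleGraph V) (A : Finset V) (v : V) : ℝ :=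
  ∑ C ∈ bicomponents G, ∑ s ∈ nbrsOfTargets G A ∩ C,
    ∑ t ∈ (nbrsOfTargets G A ∩ C ∩ twoHopSet G s).filter (fun t => G.Adj s v ∧ G.Adj v t),
      1 / (twoHopCount G s t : ℝ) * (q G C s t / (gamma G * eta G A))

/-- Second phase, the total weight `λ̂` of the two-hop paths found. -/
def exactWeight (G : SimpleGraph V) (A : Finset V) : ℝ := ∑ v ∈ A, exactRisk G A v

/-! ### The sampler -/

/-- `n² - ∑_{s ∈ C} r_C(s)²`. -/
def stageWeight (G : SimpleGraph V) (C : Finset V) : ℝ :=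
  (Fintype.card V : ℝ) ^ 2 - ∑ s ∈ C, r G C s ^ 2

/-- The probability that one iteration of the sampler proposes `p`: a bi-component `C`, a source
`s ∈ C`, a target `t ∈ C \ {s}` and a shortest path from `s` to `t` are picked in this order. -/
def proposalProb (G : SimpleGraph V) (A : Finset V) (p : ShortestPath G) : ℝ :=
  ∑ C ∈ (targetBicomponents G A).filter (fun C => p.src ∈ C ∧ p.tgt ∈ C \ {p.src}),
    (stageWeight G C / (numPairs V * (gamma G * eta G A))) *
      (r G C p.src * ((Fintype.card V : ℝ) - r G C p.src) / stageWeight G C) *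
      (r G C p.tgt / ((Fintype.card V : ℝ) - r G C p.src)) *
      (1 / (sigma G p.src p.tgt : ℝ))

/-- The probability that one iteration is rejected. -/
def rejectProb (G : SimpleGraph V) (A : Finset V) : ℝ := ∑ p ∈ exactSpace G A, proposalProb G A p

/-- The probability that the repeat-until loop, with independent iterations, returns `p`: the sum
over `k` of the probability that `k` iterations are rejected and the next one proposes the
acceptable path `p`. -/
def genProb (G : SimpleGraph V) (A : Finset V) (p : ShortestPath G) : ℝ :=
  if p ∈ exactSpace G A then 0 else ∑' k : ℕ, rejectProb G A ^ k * proposalProb G A p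

/-! ### The algorithm for betweenness centrality -/

/-- The accuracy `ε* = ε / (γ η)` that is passed to the framework. -/
def epsStar (G : SimpleGraph V) (A : Finset V) (ε : ℝ) : ℝ := ε / (gamma G * eta G A)

/-- The accuracy `ε' = ε* / λ` on the approximate subspace. -/
def epsPrime (G : SimpleGraph V) (A : Finset V) (ε : ℝ) : ℝ :=
  epsStar G A ε / (1 - exactWeight G A)

/-- The number of pilot samples. -/
def pilotSize (G : SimpleGraph V) (A : Finset V) (c ε δ : ℝ) : ℕ :=
  initSize c (epsPrime G A ε) δ

/-- The estimate of the betweenness centrality of `v`, as a function of the sequence `x` of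
samples returned by the sampler. The first `N₀` samples are the pilot samples, from which the error
probabilities are allocated; the main samples are the subsequent ones. -/
def estimate (G : SimpleGraph V) (A : Finset V) (c ε δ : ℝ) (d : ℕ)
    (alloc : (Fin (pilotSize G A c ε δ) → ShortestPath G) → A → ℝ)
    (x : ℕ → ShortestPath G) (v : A) : ℝ :=
  bcA G v + gamma G * eta G A *
    framework (fun (u : A) (p : ShortestPath G) => g (u : V) p) (exactWeight G A)
      (fun u : A => exactRisk G A u) c (epsStar G A ε) δ d
      (alloc fun j => x j) (fun j => x (pilotSize G A c ε δ + j)) v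

/-- `d` bounds the VC dimension of the hypothesis class. -/
def VCBound (G : SimpleGraph V) (A : Finset V) (d : ℕ) : Prop :=
  (hypothesisClass G A).vcDim ≤ d

end

end SaPHyRa

namespace SaPHyRa

noncomputable section

open scoped Classical

/-! ### Walks inside a set of nodes -/

section Graph

variable {V : Type*} {G : SimpleGraph V}

/-- There is a walk from `a` to `b` all of whose nodes lie in `S`. -/
def WalkIn (G : SimpleGraph V) (S : Set V) (a b : V) : Prop :=
  ∃ p : G.Walk a b, ∀ w ∈ p.support, w ∈ S

theorem WalkIn.refl {S : Set V} {a : V} (h : a ∈ S) : WalkIn G S a a :=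
  ⟨.nil, by simpa using h⟩

theorem WalkIn.symm {S : Set V} {a b : V} (h : WalkIn G S a b) : WalkIn G S b a := by
  obtain ⟨p, hp⟩ := h
  exact ⟨p.reverse, by simpa using hp⟩

theorem WalkIn.trans {S : Set V} {a b c : V} (h : WalkIn G S a b) (h' : WalkIn G S b c) :
    WalkIn G S a c := by
  obtain ⟨p, hp⟩ := h
  obtain ⟨q, hq⟩ := h'
  refine ⟨p.append q, fun w hw => ?_⟩
  rcases (SimpleGraph.Walk.mem_support_append_iff _ _).1 hw with h | h
  exacts [hp w h, hq w h]

theorem WalkIn.mono {S T : Set V} {a b : V} (hST : S ⊆ T) (h : WalkIn G S a b) :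
    WalkIn G T a b := by
  obtain ⟨p, hp⟩ := h
  exact ⟨p, fun w hw => hST (hp w hw)⟩

theorem preconnected_induce_iff {S : Set V} :
    (G.induce S).Preconnected ↔ ∀ a ∈ S, ∀ b ∈ S, WalkIn G S a b := by
  constructor
  · intro h a ha b hb
    obtain ⟨p⟩ := h ⟨a, ha⟩ ⟨b, hb⟩
    refine ⟨p.map (SimpleGraph.Embedding.induce S).toHom, fun w hw => ?_⟩
    obtain ⟨x, -, rfl⟩ := List.mem_map.1 ((SimpleGraph.Walk.support_map _ _) ▸ hw)
    exact x.2
  · rintro h ⟨a, ha⟩ ⟨b, hb⟩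
    obtain ⟨p, hp⟩ := h a ha b hb
    exact ⟨p.induce S hp⟩

end Graph

section Blocks

variable {V : Type*} {G : SimpleGraph V} {C C' D : Finset V}

theorem isNonseparable_iff : IsNonseparable G C ↔ C.Nonempty ∧
    (∀ a ∈ C, ∀ b ∈ C, WalkIn G (C : Set V) a b) ∧
    ∀ w ∈ C, ∀ a ∈ C, a ≠ w → ∀ b ∈ C, b ≠ w → WalkIn G ((C : Set V) \ {w}) a b := by
  unfold IsNonseparable
  rw [SimpleGraph.connected_iff, preconnected_induce_iff]
  simp only [preconnected_induce_iff, Finset.mem_coe, Set.mem_sdiff, Set.mem_singleton_iff,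
    and_imp, Set.nonempty_coe_sort, Finset.coe_nonempty]
  tauto

theorem IsNonseparable.walkIn_diff (h : IsNonseparable G C) {w a b : V} (ha : a ∈ C) (haw : a ≠ w)
    (hb : b ∈ C) (hbw : b ≠ w) : WalkIn G ((C : Set V) \ {w}) a b := by
  obtain ⟨-, h1, h2⟩ := isNonseparable_iff.1 h
  by_cases hw : w ∈ C
  · exact h2 w hw a ha haw b hb hbw
  · refine (h1 a ha b hb).mono fun x hx => ⟨hx, ?_⟩
    rintro rfl
    exact hw hx

/-- A set stays nonseparable when nodes are added that, after the removal of any other node, are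
still connected to it. -/
theorem IsNonseparable.enlarge (h : IsNonseparable G C) (hCD : C ⊆ D)
    (hD : ∀ z ∈ D, ∀ w, z ≠ w → ∃ c ∈ C, c ≠ w ∧ WalkIn G ((D : Set V) \ {w}) z c) :
    IsNonseparable G D := by
  obtain ⟨⟨c₀, hc₀⟩, h1, -⟩ := isNonseparable_iff.1 h
  have hCD' : (C : Set V) ⊆ D := Finset.coe_subset.2 hCD
  have key : ∀ z ∈ D, WalkIn G (D : Set V) z c₀ := by
    intro z hz
    by_cases hzc : z = c₀
    · subst hzc; exact WalkIn.refl hz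
    · obtain ⟨c, hc, -, hw⟩ := hD z hz c₀ hzc
      exact (hw.mono Set.sdiff_subset).trans ((h1 c hc c₀ hc₀).mono hCD')
  refine isNonseparable_iff.2 ⟨⟨c₀, hCD hc₀⟩, fun a ha b hb => (key a ha).trans (key b hb).symm,
    fun w _ a ha haw b hb hbw => ?_⟩
  obtain ⟨c, hc, hcw, hac⟩ := hD a ha w haw
  obtain ⟨c', hc', hcw', hbc⟩ := hD b hb w hbw
  exact (hac.trans ((h.walkIn_diff hc hcw hc' hcw').mono
    (Set.sdiff_subset_sdiff_left hCD'))).trans hbc.symm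

theorem IsNonseparable.union (h : IsNonseparable G C) (h' : IsNonseparable G C') {a b : V}
    (hab : a ≠ b) (ha : a ∈ C) (ha' : a ∈ C') (hb : b ∈ C) (hb' : b ∈ C') :
    IsNonseparable G (C ∪ C') := by
  refine h.enlarge Finset.subset_union_left fun z hz w hzw => ?_
  rcases Finset.mem_union.1 hz with hz' | hz'
  · exact ⟨z, hz', hzw, WalkIn.refl ⟨by exact_mod_cast hz, hzw⟩⟩
  · have hsub : ((C' : Set V) \ {w}) ⊆ ((C ∪ C' : Finset V) : Set V) \ {w} :=
      Set.sdiff_subset_sdiff_left (Finset.coe_subset.2 Finset.subset_union_right)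
    by_cases haw : a = w
    · exact ⟨b, hb, fun e => hab (haw.trans e.symm),
        (h'.walkIn_diff hz' hzw hb' fun e => hab (haw.trans e.symm)).mono hsub⟩
    · exact ⟨a, ha, haw, (h'.walkIn_diff hz' hzw ha' haw).mono hsub⟩

/-- Adding an ear to a nonseparable set. -/
theorem IsNonseparable.union_support (h : IsNonseparable G C) {s t : V} (hs : s ∈ C) (ht : t ∈ C)
    {p : G.Walk s t} (hp : p.IsPath) : IsNonseparable G (C ∪ p.support.toFinset) := by
  refine h.enlarge Finset.subset_union_left fun z hz w hzw => ?_
  rcases Finset.mem_union.1 hz with hz' | hz'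
  · exact ⟨z, hz', hzw, WalkIn.refl ⟨by exact_mod_cast hz, hzw⟩⟩
  · rw [List.mem_toFinset] at hz'
    have hsub : ∀ x ∈ p.support, x ≠ w →
        x ∈ ((C ∪ p.support.toFinset : Finset V) : Set V) \ {w} := fun x hx hxw =>
      ⟨by simp [hx], hxw⟩
    by_cases hw : w ∈ (p.takeUntil z hz').support
    · have hw' : w ∉ (p.dropUntil z hz').support := by
        intro hw'
        rw [SimpleGraph.Walk.mem_support_iff] at hw'
        rcases hw' with rfl | hw'
        · exact hzw rfl
        · have hp' := hp
          rw [← p.take_spec hz'] at hp'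
          have := hp'.support_nodup
          rw [SimpleGraph.Walk.support_append] at this
          exact (List.disjoint_of_nodup_append this) hw hw'
      refine ⟨t, ht, ?_, p.dropUntil z hz', fun x hx =>
        hsub x (p.support_dropUntil_subset_support hz' hx) ?_⟩
      · rintro rfl; exact hw' (SimpleGraph.Walk.end_mem_support _)
      · rintro rfl; exact hw' hx
    · refine ⟨s, hs, ?_, WalkIn.symm ⟨p.takeUntil z hz', fun x hx =>
        hsub x (p.support_takeUntil_subset_support hz' hx) ?_⟩⟩
      · rintro rfl; exact hw (SimpleGraph.Walk.start_mem_support _)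
      · rintro rfl; exact hw hx

theorem isNonseparable_pair {a b : V} (h : G.Adj a b) : IsNonseparable G {a, b} := by
  have hab : WalkIn G (({a, b} : Finset V) : Set V) a b := ⟨h.toWalk, by simp⟩
  refine isNonseparable_iff.2 ⟨⟨a, by simp⟩, ?_, ?_⟩
  · intro x hx y hy
    simp only [Finset.mem_insert, Finset.mem_singleton] at hx hy
    rcases hx with rfl | rfl <;> rcases hy with rfl | rfl
    · exact WalkIn.refl (by simp)
    · exact hab
    · exact hab.symm
    · exact WalkIn.refl (by simp)
  · intro w hw x hx hxw y hy hyw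
    have : x = y := by
      simp only [Finset.mem_insert, Finset.mem_singleton] at hx hy hw
      grind
    subst this
    exact WalkIn.refl ⟨by exact_mod_cast hx, hxw⟩

variable [Fintype V]

theorem mem_bicomponents : C ∈ bicomponents G ↔ Maximal (IsNonseparable G) C := by
  simp [bicomponents]

theorem exists_bicomponent_of_adj {a b : V} (h : G.Adj a b) :
    ∃ C ∈ bicomponents G, a ∈ C ∧ b ∈ C := by
  obtain ⟨C, hC, hm⟩ := Finite.exists_le_maximal (isNonseparable_pair h)
  exact ⟨C, mem_bicomponents.2 hm, hC (by simp), hC (by simp)⟩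

theorem bicomponent_nonempty (hC : C ∈ bicomponents G) : C.Nonempty :=
  (isNonseparable_iff.1 (mem_bicomponents.1 hC).1).1

theorem bicomponents_eq_of_two_mem (hC : C ∈ bicomponents G) (hC' : C' ∈ bicomponents G) {a b : V}
    (hab : a ≠ b) (ha : a ∈ C) (ha' : a ∈ C') (hb : b ∈ C) (hb' : b ∈ C') : C = C' := by
  have hm := mem_bicomponents.1 hC
  have hm' := mem_bicomponents.1 hC'
  have hu := hm.1.union hm'.1 hab ha ha' hb hb'
  have h1 : C ∪ C' ⊆ C := hm.2 hu Finset.subset_union_left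
  have h2 : C ∪ C' ⊆ C' := hm'.2 hu Finset.subset_union_right
  exact (Finset.subset_union_left.trans h2).antisymm (Finset.subset_union_right.trans h1)

/-! ### Out reach sets -/

theorem mem_outReach {v u : V} :
    u ∈ outReach G C v ↔ ∃ p : G.Walk v u, ∀ w ∈ p.support, w ∈ C → w = v := by
  simp [outReach]

theorem self_mem_outReach (v : V) : v ∈ outReach G C v :=
  mem_outReach.2 ⟨.nil, by simp⟩

theorem eq_of_mem_outReach_of_mem {u v : V} (hu : u ∈ C) (h : u ∈ outReach G C v) : u = v := by
  obtain ⟨p, hp⟩ := mem_outReach.1 h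
  exact hp u p.end_mem_support hu

/-- The out reach sets of the nodes of a bi-component are disjoint. -/
theorem outReach_unique (hC : C ∈ bicomponents G) {s t u : V} (hs : s ∈ C) (ht : t ∈ C)
    (hus : u ∈ outReach G C s) (hut : u ∈ outReach G C t) : s = t := by
  by_contra hst
  have huC : u ∉ C := fun hu =>
    hst ((eq_of_mem_outReach_of_mem hu hus).symm.trans (eq_of_mem_outReach_of_mem hu hut))
  obtain ⟨p, hp⟩ := mem_outReach.1 hus
  obtain ⟨q, hq⟩ := mem_outReach.1 hut
  set W := p.append q.reverse with hW
  have hm := mem_bicomponents.1 hC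
  have hsub : C ∪ W.bypass.support.toFinset ⊆ C :=
    hm.2 (hm.1.union_support hs ht W.bypass_isPath) Finset.subset_union_left
  have hin : ∀ x ∈ W.bypass.support, x = s ∨ x = t := by
    intro x hx
    have hxC : x ∈ C := hsub (by simp [hx])
    rcases (SimpleGraph.Walk.mem_support_append_iff _ _).1 (W.support_bypass_subset_support hx) with h | h
    · exact Or.inl (hp x h hxC)
    · exact Or.inr (hq x (by simpa using h) hxC)
  have hedge : s(s, t) ∈ W.bypass.edges := by
    generalize W.bypass = P at hin
    cases P with
    | nil => exact absurd rfl hst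
    | cons hadj P' =>
      rename_i b
      have hb : b = s ∨ b = t := hin b (by simp)
      rcases hb with rfl | rfl
      · exact absurd hadj G.irrefl
      · simp
  have hedge' := W.edges_bypass_subset_edges hedge
  rw [hW, SimpleGraph.Walk.edges_append, List.mem_append] at hedge'
  rcases hedge' with h | h
  · exact hst (hp t (p.snd_mem_support_of_mem_edges h) ht).symm
  · rw [SimpleGraph.Walk.edges_reverse, List.mem_reverse] at h
    exact hst (hq s (q.fst_mem_support_of_mem_edges h) hs)

/-- A walk that ends in `C` has a first node in `C`. -/
theorem exists_mem_outReach_of_walk {x y : V} (p : G.Walk x y) (hy : y ∈ C) :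
    ∃ s ∈ C, s ∈ p.support ∧ x ∈ outReach G C s := by
  induction p with
  | nil => exact ⟨_, hy, by simp, self_mem_outReach _⟩
  | @cons a b c hadj p ih =>
    by_cases ha : a ∈ C
    · exact ⟨a, ha, by simp, self_mem_outReach _⟩
    · obtain ⟨s, hs, hsp, hb⟩ := ih hy
      obtain ⟨q, hq⟩ := mem_outReach.1 hb
      refine ⟨s, hs, by simp [hsp], mem_outReach.2 ⟨q.concat hadj.symm, fun w hw hwC => ?_⟩⟩
      rw [SimpleGraph.Walk.support_concat, List.mem_append] at hw
      rcases hw with hw | hw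
      · exact hq w hw hwC
      · simp only [List.mem_singleton] at hw
        subst hw
        exact absurd hwC ha

theorem exists_mem_outReach (hG : G.Connected) (hC : C ∈ bicomponents G) (x : V) :
    ∃ s ∈ C, x ∈ outReach G C s := by
  obtain ⟨c, hc⟩ := bicomponent_nonempty hC
  obtain ⟨p⟩ := hG x c
  obtain ⟨s, hs, -, h⟩ := exists_mem_outReach_of_walk p hc
  exact ⟨s, hs, h⟩

/-- Walks between different out reach sets pass through the nodes of `C` they belong to. -/
theorem mem_support_of_outReach (hC : C ∈ bicomponents G) {s t x y : V} (hs : s ∈ C) (ht : t ∈ C)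
    (hst : s ≠ t) (hx : x ∈ outReach G C s) (hy : y ∈ outReach G C t) (p : G.Walk x y) :
    s ∈ p.support := by
  obtain ⟨q, hq⟩ := mem_outReach.1 hy
  obtain ⟨u, hu, hup, hxu⟩ := exists_mem_outReach_of_walk (p.append q.reverse) ht
  obtain rfl := outReach_unique hC hu hs hxu hx
  rcases (SimpleGraph.Walk.mem_support_append_iff _ _).1 hup with h | h
  · exact h
  · exact absurd (hq u (by simpa using h) hu) hst

/-- For `x ≠ v` there is a bi-component at `v` in which `x` is not in the out reach set of `v`. -/
theorem exists_bicomponent_notMem_outReach (hG : G.Connected) {v x : V} (hxv : x ≠ v) :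
    ∃ C ∈ bicomponents G, v ∈ C ∧ x ∉ outReach G C v := by
  obtain ⟨p, hp⟩ := (hG v x).exists_isPath
  cases p with
  | nil => exact absurd rfl hxv
  | @cons _ b _ hadj p =>
    obtain ⟨C, hC, hv, hb⟩ := exists_bicomponent_of_adj hadj
    refine ⟨C, hC, hv, fun hx => ?_⟩
    have hnd := (SimpleGraph.Walk.cons_isPath_iff hadj p).1 hp
    obtain ⟨s, hs, hsp, hxs⟩ := exists_mem_outReach_of_walk p.reverse hb
    have := outReach_unique hC hs hv hxs hx
    subst this
    exact hnd.2 (by simpa using hsp)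

theorem bicomponent_unique_of_notMem_outReach (hG : G.Connected) (hC : C ∈ bicomponents G)
    (hC' : C' ∈ bicomponents G) {v x : V} (hv : v ∈ C) (hv' : v ∈ C')
    (hx : x ∉ outReach G C v) (hx' : x ∉ outReach G C' v) : C = C' := by
  by_contra hne
  have hinter : ∀ y ∈ C', y ∈ C → y = v := fun y hy' hy => by
    by_contra hyv
    exact hne (bicomponents_eq_of_two_mem hC hC' hyv hy hy' hv hv')
  obtain ⟨s, hs, hxs⟩ := exists_mem_outReach hG hC x
  obtain ⟨s', hs', hxs'⟩ := exists_mem_outReach hG hC' x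
  have hsv : s ≠ v := by rintro rfl; exact hx hxs
  have hsv' : s' ≠ v := by rintro rfl; exact hx' hxs'
  obtain ⟨q, hq⟩ := (isNonseparable_iff.1 (mem_bicomponents.1 hC').1).2.1 v hv' s' hs'
  have hsR : s' ∈ outReach G C v :=
    mem_outReach.2 ⟨q, fun w hw hwC => hinter w (by exact_mod_cast hq w hw) hwC⟩
  obtain ⟨p, hp⟩ := mem_outReach.1 hxs'
  have := mem_support_of_outReach hC hv hs hsv.symm hsR hxs p
  exact hsv' (hp v this hv').symm

theorem exists_adj_mem_bicomponent (hG : G.Connected) (hV : 2 ≤ Fintype.card V)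
    (hC : C ∈ bicomponents G) {s : V} (hs : s ∈ C) : ∃ t ∈ C, G.Adj s t := by
  have : Nontrivial V := Fintype.one_lt_card_iff_nontrivial.1 hV
  by_cases h : ∃ t ∈ C, t ≠ s
  · obtain ⟨t, ht, hts⟩ := h
    obtain ⟨p, hp⟩ := (isNonseparable_iff.1 (mem_bicomponents.1 hC).1).2.1 s hs t ht
    cases p with
    | nil => exact absurd rfl hts
    | @cons _ b _ hadj p => exact ⟨b, by exact_mod_cast hp b (by simp), hadj⟩
  · push Not at h
    obtain ⟨u, hu⟩ := hG.preconnected.exists_adj_of_nontrivial s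
    obtain ⟨D, hD, hsD, huD⟩ := exists_bicomponent_of_adj hu
    have : C ⊆ D := fun x hx => by rw [h x hx]; exact hsD
    exact ⟨u, (mem_bicomponents.1 hC).2 (mem_bicomponents.1 hD).1 this huD, hu⟩

/-- The node of `C` whose out reach set contains `x`. -/
def proj (G : SimpleGraph V) (C : Finset V) (x : V) : V :=
  if h : ∃ s ∈ C, x ∈ outReach G C s then h.choose else x

theorem proj_mem (hG : G.Connected) (hC : C ∈ bicomponents G) (x : V) : proj G C x ∈ C := by
  have h := exists_mem_outReach hG hC x
  rw [proj, dif_pos h]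
  exact h.choose_spec.1

theorem mem_outReach_proj (hG : G.Connected) (hC : C ∈ bicomponents G) (x : V) :
    x ∈ outReach G C (proj G C x) := by
  have h := exists_mem_outReach hG hC x
  rw [proj, dif_pos h]
  exact h.choose_spec.2

theorem mem_outReach_iff_proj (hG : G.Connected) (hC : C ∈ bicomponents G) {s x : V}
    (hs : s ∈ C) : x ∈ outReach G C s ↔ proj G C x = s := by
  constructor
  · exact fun h => outReach_unique hC (proj_mem hG hC x) hs (mem_outReach_proj hG hC x) h
  · rintro rfl
    exact mem_outReach_proj hG hC x

theorem proj_of_mem (hG : G.Connected) (hC : C ∈ bicomponents G) {s : V} (hs : s ∈ C) :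
    proj G C s = s :=
  (mem_outReach_iff_proj hG hC hs).1 (self_mem_outReach s)

theorem r_eq_card_proj (hG : G.Connected) (hC : C ∈ bicomponents G) {s : V} (hs : s ∈ C) :
    r G C s = ∑ x : V, if proj G C x = s then 1 else 0 := by
  rw [r, Finset.sum_boole]
  congr 2
  ext x
  simp [mem_outReach_iff_proj hG hC hs]

/-- Sums over nodes weighted with the sizes of the out reach sets are sums over all nodes. -/
theorem sum_r_mul (hG : G.Connected) (hC : C ∈ bicomponents G) (f : V → ℝ) :
    ∑ s ∈ C, r G C s * f s = ∑ x : V, f (proj G C x) := by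
  have h : ∀ s ∈ C, r G C s * f s = ∑ x : V, if proj G C x = s then f s else 0 := by
    intro s hs
    rw [r_eq_card_proj hG hC hs, Finset.sum_mul]
    exact Finset.sum_congr rfl fun x _ => by split_ifs <;> simp
  rw [Finset.sum_congr rfl h, Finset.sum_comm]
  refine Finset.sum_congr rfl fun x _ => ?_
  rw [Finset.sum_ite_eq, if_pos (proj_mem hG hC x)]

theorem sum_r (hG : G.Connected) (hC : C ∈ bicomponents G) :
    ∑ s ∈ C, r G C s = Fintype.card V := by
  have := sum_r_mul hG hC fun _ => 1
  simpa using this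

theorem r_pos (s : V) : 0 < r G C s := by
  unfold r
  exact_mod_cast Finset.card_pos.2 ⟨s, self_mem_outReach s⟩

end Blocks

/-! ### Counting shortest paths -/

section Counting

variable {V : Type*} {G : SimpleGraph V}

theorem append_inj {x v y : V} {a a' : G.Walk x v} {b b' : G.Walk v y}
    (hl : a.length = a'.length) (h : a.append b = a'.append b') : a = a' ∧ b = b' := by
  have hs := congrArg SimpleGraph.Walk.support h
  rw [SimpleGraph.Walk.support_append, SimpleGraph.Walk.support_append] at hs
  obtain ⟨h1, h2⟩ := List.append_inj hs (by simp [hl])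
  refine ⟨SimpleGraph.Walk.ext_support h1, SimpleGraph.Walk.ext_support ?_⟩
  rw [← b.cons_tail_support, ← b'.cons_tail_support, h2]

variable [Fintype V]

/-- Shortest paths with given end points, as walks. -/
def shortestPathEquiv (G : SimpleGraph V) (s t : V) (Q : ∀ {a b : V}, G.Walk a b → Prop) :
    {p : ShortestPath G // p.src = s ∧ p.tgt = t ∧ Q p.walk} ≃
      {w : G.Walk s t // w.length = G.dist s t ∧ Q w} where
  toFun p := ⟨p.1.walk.copy p.2.1 p.2.2.1, by
    obtain ⟨⟨a, b, w, hw⟩, h1, h2, h3⟩ := p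
    dsimp only at h1 h2 h3
    subst h1 h2
    exact ⟨hw, h3⟩⟩
  invFun w := ⟨⟨s, t, w.1, w.2.1⟩, rfl, rfl, w.2.2⟩
  left_inv p := by
    obtain ⟨⟨a, b, w, hw⟩, h1, h2, h3⟩ := p
    dsimp only at h1 h2 h3
    subst h1 h2
    rfl
  right_inv w := rfl

theorem sigma_eq_natCard (s t : V) :
    sigma G s t = Nat.card {w : G.Walk s t // w.length = G.dist s t} := by
  have e := Nat.card_congr (shortestPathEquiv G s t fun _ => True)
  simp only [and_true] at e
  rw [← e, sigma, Nat.card_eq_fintype_card, Fintype.card_subtype]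

theorem sigmaThrough_eq_natCard (s t v : V) :
    sigmaThrough G s t v =
      Nat.card {w : G.Walk s t // w.length = G.dist s t ∧ v ∈ w.support} := by
  rw [← Nat.card_congr (shortestPathEquiv G s t fun w => v ∈ w.support), sigmaThrough,
    Nat.card_eq_fintype_card, Fintype.card_subtype]

theorem sigmaThrough_eq_mul {x y v : V} (h : G.dist x v + G.dist v y = G.dist x y) :
    sigmaThrough G x y v = sigma G x v * sigma G v y := by
  rw [sigmaThrough_eq_natCard, sigma_eq_natCard, sigma_eq_natCard, ← Nat.card_prod]
  symm
  refine Nat.card_congr (Equiv.ofBijective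
    (fun ab => ⟨ab.1.1.append ab.2.1, ?_, ?_⟩) ⟨?_, ?_⟩)
  · rw [SimpleGraph.Walk.length_append, ab.1.2, ab.2.2, h]
  · exact (SimpleGraph.Walk.mem_support_append_iff _ _).2 (Or.inl (SimpleGraph.Walk.end_mem_support _))
  · rintro ⟨⟨a, ha⟩, ⟨b, hb⟩⟩ ⟨⟨a', ha'⟩, ⟨b', hb'⟩⟩ e
    obtain ⟨rfl, rfl⟩ := append_inj (ha.trans ha'.symm) (congrArg Subtype.val e)
    rfl
  · rintro ⟨w, hw, hv⟩
    have hl : (w.takeUntil v hv).length + (w.dropUntil v hv).length = w.length := by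
      rw [← SimpleGraph.Walk.length_append, w.take_spec]
    have h1 := SimpleGraph.dist_le (w.takeUntil v hv)
    have h2 := SimpleGraph.dist_le (w.dropUntil v hv)
    exact ⟨⟨⟨w.takeUntil v hv, by omega⟩, ⟨w.dropUntil v hv, by omega⟩⟩,
      Subtype.ext (w.take_spec hv)⟩

theorem sigmaThrough_eq_zero (hG : G.Connected) {x y v : V}
    (h : G.dist x v + G.dist v y ≠ G.dist x y) : sigmaThrough G x y v = 0 := by
  rw [sigmaThrough_eq_natCard, Nat.card_eq_zero]
  refine Or.inl ⟨fun ⟨w, hw, hv⟩ => h (le_antisymm ?_ hG.dist_triangle)⟩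
  rw [← hw, ← congrArg SimpleGraph.Walk.length (w.take_spec hv), SimpleGraph.Walk.length_append]
  exact Nat.add_le_add (SimpleGraph.dist_le _) (SimpleGraph.dist_le _)

theorem sigma_pos (hG : G.Connected) (s t : V) : 0 < sigma G s t := by
  obtain ⟨p, hp⟩ := hG.exists_walk_length_eq_dist s t
  exact Finset.card_pos.2 ⟨⟨s, t, p, hp⟩, by simp⟩

theorem sigmaThrough_of_forall_mem {x y v : V} (h : ∀ p : G.Walk x y, v ∈ p.support) :
    sigmaThrough G x y v = sigma G x y := by
  rw [sigmaThrough_eq_natCard, sigma_eq_natCard]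
  exact Nat.card_congr (Equiv.subtypeEquivRight fun w => by simp [h w])

theorem dist_eq_of_forall_mem (hG : G.Connected) {x y s : V}
    (h : ∀ p : G.Walk x y, s ∈ p.support) : G.dist x s + G.dist s y = G.dist x y := by
  by_contra hne
  have h1 := sigmaThrough_eq_zero hG hne
  rw [sigmaThrough_of_forall_mem h] at h1
  exact (sigma_pos hG x y).ne' h1

theorem sigma_eq_of_forall_mem (hG : G.Connected) {x y s : V}
    (h : ∀ p : G.Walk x y, s ∈ p.support) : sigma G x y = sigma G x s * sigma G s y := by
  rw [← sigmaThrough_of_forall_mem h, sigmaThrough_eq_mul (dist_eq_of_forall_mem hG h)]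

/-- The fraction `σ_{st}(v) / σ_{st}`. -/
def ratio (G : SimpleGraph V) (s t v : V) : ℝ := (sigmaThrough G s t v : ℝ) / (sigma G s t : ℝ)

theorem ratio_eq_zero (hG : G.Connected) {x y v : V}
    (h : G.dist x v + G.dist v y ≠ G.dist x y) : ratio G x y v = 0 := by
  simp [ratio, sigmaThrough_eq_zero hG h]

theorem ratio_eq_mul {x y v : V} (h : G.dist x v + G.dist v y = G.dist x y) :
    ratio G x y v = (sigma G x v * sigma G v y : ℝ) / sigma G x y := by
  simp [ratio, sigmaThrough_eq_mul h]

theorem ratio_of_forall_mem (hG : G.Connected) {x y v : V} (h : ∀ p : G.Walk x y, v ∈ p.support) :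
    ratio G x y v = 1 := by
  rw [ratio, sigmaThrough_of_forall_mem h, div_self]
  exact_mod_cast (sigma_pos hG x y).ne'

end Counting

/-! ### Decomposition of betweenness centrality -/

section Decomposition

variable {V : Type*} [Fintype V] {G : SimpleGraph V} {C C' : Finset V}

theorem mem_support_proj (hG : G.Connected) (hC : C ∈ bicomponents G) {x y : V}
    (h : proj G C x ≠ proj G C y) (p : G.Walk x y) : proj G C x ∈ p.support :=
  mem_support_of_outReach hC (proj_mem hG hC x) (proj_mem hG hC y) h
    (mem_outReach_proj hG hC x) (mem_outReach_proj hG hC y) p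

theorem mem_support_proj' (hG : G.Connected) (hC : C ∈ bicomponents G) {x y : V}
    (h : proj G C x ≠ proj G C y) (p : G.Walk x y) : proj G C y ∈ p.support := by
  simpa using mem_support_proj hG hC h.symm p.reverse

/-- Shortest paths between different out reach sets pass through `v ∈ C` in the same proportion
as the ones between the corresponding nodes of `C`. -/
theorem ratio_proj (hG : G.Connected) (hC : C ∈ bicomponents G) {x y v : V} (hv : v ∈ C)
    (hx : proj G C x ≠ v) (hy : proj G C y ≠ v) :
    ratio G x y v = ratio G (proj G C x) (proj G C y) v := by
  have hpv := proj_of_mem hG hC hv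
  have hxv : ∀ p : G.Walk x v, proj G C x ∈ p.support := mem_support_proj hG hC (by rwa [hpv])
  have hvy : ∀ p : G.Walk v y, proj G C y ∈ p.support :=
    mem_support_proj' hG hC (by rw [hpv]; exact hy.symm)
  have d1 := dist_eq_of_forall_mem hG hxv
  have d2 := dist_eq_of_forall_mem hG hvy
  have hps := proj_of_mem hG hC (proj_mem hG hC x)
  have hpt := proj_of_mem hG hC (proj_mem hG hC y)
  by_cases hst : proj G C x = proj G C y
  · have p1 := hG.pos_dist_of_ne hx
    have p2 := hG.dist_triangle (u := x) (v := proj G C x) (w := y)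
    rw [← hst] at d2 ⊢
    rw [ratio_eq_zero hG, ratio_eq_zero hG]
    · rw [SimpleGraph.dist_self]; omega
    · omega
  · have hsy : ∀ p : G.Walk (proj G C x) y, proj G C y ∈ p.support :=
      mem_support_proj' hG hC (by rwa [hps])
    have hxy : ∀ p : G.Walk x y, proj G C x ∈ p.support := mem_support_proj hG hC hst
    have d3 := dist_eq_of_forall_mem hG hxy
    have d4 := dist_eq_of_forall_mem hG hsy
    by_cases hd : G.dist (proj G C x) v + G.dist v (proj G C y) =
        G.dist (proj G C x) (proj G C y)
    · rw [ratio_eq_mul hd, ratio_eq_mul (by omega), sigma_eq_of_forall_mem hG hxv,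
        sigma_eq_of_forall_mem hG hvy, sigma_eq_of_forall_mem hG hxy,
        sigma_eq_of_forall_mem hG hsy]
      have n1 : (sigma G x (proj G C x) : ℝ) ≠ 0 := by exact_mod_cast (sigma_pos hG _ _).ne'
      have n2 : (sigma G (proj G C x) (proj G C y) : ℝ) ≠ 0 := by
        exact_mod_cast (sigma_pos hG _ _).ne'
      have n3 : (sigma G (proj G C y) y : ℝ) ≠ 0 := by exact_mod_cast (sigma_pos hG _ _).ne'
      push_cast
      field_simp
    · rw [ratio_eq_zero hG hd, ratio_eq_zero hG (by omega)]

/-- A shortest path between nodes of a bi-component stays inside it. -/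
theorem ratio_eq_zero_of_notMem (hG : G.Connected) (hC : C ∈ bicomponents G) {s t v : V}
    (hs : s ∈ C) (ht : t ∈ C) (hv : v ∉ C) : ratio G s t v = 0 := by
  have hu := proj_mem hG hC v
  have huv : v ≠ proj G C v := by rintro h; rw [h] at hv; exact hv hu
  have key : ∀ s ∈ C, G.dist s (proj G C v) + G.dist (proj G C v) v = G.dist s v := by
    intro s hs
    by_cases h : s = proj G C v
    · rw [← h]; simp
    · exact dist_eq_of_forall_mem hG (mem_support_proj' hG hC (by rwa [proj_of_mem hG hC hs]))
  have k1 := key s hs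
  have k2 := key t ht
  have k3 := hG.dist_triangle (u := s) (v := proj G C v) (w := t)
  have k4 := hG.pos_dist_of_ne huv
  rw [SimpleGraph.dist_comm (u := t), SimpleGraph.dist_comm (u := t)] at k2
  rw [SimpleGraph.dist_comm (u := v)] at k4
  exact ratio_eq_zero hG (by omega)

theorem proj_eq_of_ne (hG : G.Connected) (hC : C ∈ bicomponents G) (hC' : C' ∈ bicomponents G)
    {v x : V} (hv : v ∈ C) (hv' : v ∈ C') (hne : C ≠ C') (hx : proj G C x ≠ v) :
    proj G C' x = v := by
  by_contra h
  rw [ne_eq, ← mem_outReach_iff_proj hG hC hv] at hx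
  rw [← mem_outReach_iff_proj hG hC' hv'] at h
  exact hne (bicomponent_unique_of_notMem_outReach hG hC hC' hv hv' hx h)

theorem ratio_eq_one_of_ne (hG : G.Connected) (hC : C ∈ bicomponents G) (hC' : C' ∈ bicomponents G)
    {v x y : V} (hv : v ∈ C) (hv' : v ∈ C') (hne : C ≠ C') (hx : proj G C x ≠ v)
    (hy : proj G C' y ≠ v) : ratio G x y v = 1 := by
  have h := proj_eq_of_ne hG hC' hC hv' hv hne.symm hy
  refine ratio_of_forall_mem hG fun p => ?_
  have := mem_support_proj' hG hC (x := x) (y := y) (by rwa [h]) p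
  rwa [h] at this

/-- The part of the betweenness centrality of `v` that comes from the bi-component `C`. -/
def innerWeight (G : SimpleGraph V) (C : Finset V) (v : V) : ℝ :=
  ∑ s ∈ C, r G C s * ∑ t ∈ C, r G C t * if s ≠ v ∧ t ≠ v then ratio G s t v else 0

theorem innerWeight_eq_zero (hG : G.Connected) (hC : C ∈ bicomponents G) {v : V} (hv : v ∉ C) :
    innerWeight G C v = 0 := by
  refine Finset.sum_eq_zero fun s hs => mul_eq_zero_of_right _ (Finset.sum_eq_zero fun t ht => ?_)
  rw [ratio_eq_zero_of_notMem hG hC hs ht hv, ite_self, mul_zero]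

theorem innerWeight_eq_sum (hG : G.Connected) (hC : C ∈ bicomponents G) {v : V} (hv : v ∈ C) :
    innerWeight G C v =
      ∑ x, ∑ y, if proj G C x ≠ v ∧ proj G C y ≠ v then ratio G x y v else 0 := by
  rw [innerWeight, sum_r_mul hG hC fun s =>
    ∑ t ∈ C, r G C t * if s ≠ v ∧ t ≠ v then ratio G s t v else 0]
  refine Finset.sum_congr rfl fun x _ => ?_
  rw [sum_r_mul hG hC fun t => if proj G C x ≠ v ∧ t ≠ v then ratio G (proj G C x) t v else 0]
  refine Finset.sum_congr rfl fun y _ => ?_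
  split_ifs with h
  · exact (ratio_proj hG hC hv h.1 h.2).symm
  · rfl

theorem tSize_eq_sum (hG : G.Connected) (hC : C ∈ bicomponents G) {v : V} (hv : v ∈ C) :
    tSize G C v = ∑ x, if proj G C x ≠ v then 1 else 0 := by
  rw [tSize, Finset.sum_boole]
  congr 2
  ext x
  simp [mem_outReach_iff_proj hG hC hv]

theorem sum_bicomponents_proj_ne (hG : G.Connected) (v x : V) :
    (∑ C ∈ (bicomponents G).filter (fun C => v ∈ C), if proj G C x ≠ v then (1 : ℝ) else 0) =
      if x ≠ v then 1 else 0 := by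
  split_ifs with hx
  · obtain ⟨C, hC, hv, hxC⟩ := exists_bicomponent_notMem_outReach hG hx
    rw [mem_outReach_iff_proj hG hC hv] at hxC
    rw [Finset.sum_eq_single C]
    · rw [if_pos hxC]
    · intro D hD hne
      rw [Finset.mem_filter] at hD
      rw [if_neg]
      simpa using proj_eq_of_ne hG hC hD.1 hv hD.2 hne.symm hxC
    · intro h
      exact absurd (Finset.mem_filter.2 ⟨hC, hv⟩) h
  · refine Finset.sum_eq_zero fun D hD => ?_
    rw [Finset.mem_filter] at hD
    simp only [ne_eq, not_not] at hx
    rw [if_neg]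
    simpa [hx] using proj_of_mem hG hD.1 hD.2

theorem sum_ratio_eq (hG : G.Connected) (v : V) :
    ∑ s ∈ Finset.univ.erase v, ∑ t ∈ Finset.univ.erase v, ratio G s t v =
      ∑ C ∈ (bicomponents G).filter (fun C => v ∈ C),
        (innerWeight G C v + tSize G C v *
          ∑ C' ∈ ((bicomponents G).erase C).filter (fun C' => v ∈ C'), tSize G C' v) := by
  set B := (bicomponents G).filter (fun C => v ∈ C) with hB
  have hBm : ∀ C ∈ B, C ∈ bicomponents G ∧ v ∈ C := fun C hC => by simpa [hB] using hC
  have h1 : ∑ s ∈ Finset.univ.erase v, ∑ t ∈ Finset.univ.erase v, ratio G s t v =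
      ∑ x, ∑ y, ∑ C ∈ B, ∑ C' ∈ B,
        if proj G C x ≠ v ∧ proj G C' y ≠ v then ratio G x y v else 0 := by
    have h : ∀ x y, (∑ C ∈ B, ∑ C' ∈ B,
        if proj G C x ≠ v ∧ proj G C' y ≠ v then ratio G x y v else 0) =
          if x ≠ v then if y ≠ v then ratio G x y v else 0 else 0 := by
      intro x y
      have e := congrArg₂ (· * ·) (sum_bicomponents_proj_ne hG v x)
        (sum_bicomponents_proj_ne hG v y)
      simp only [← hB, Finset.sum_mul_sum] at e
      have e' := congrArg (· * ratio G x y v) e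
      simp only [Finset.sum_mul] at e'
      calc _ = _ := Finset.sum_congr rfl fun C _ => Finset.sum_congr rfl fun C' _ => by
              rw [ite_and, ite_mul, ite_mul, one_mul, zero_mul, ite_mul, one_mul, zero_mul]
        _ = _ := e'
        _ = _ := by rw [ite_mul, one_mul, zero_mul, ite_mul, ite_mul, one_mul, zero_mul]
    simp only [h]
    rw [← Finset.filter_ne', Finset.sum_filter]
    refine Finset.sum_congr rfl fun x _ => ?_
    rw [Finset.sum_filter]
    split_ifs
    · rfl
    · exact Finset.sum_const_zero.symm
  have h2 : ∀ C ∈ B, ∀ C' ∈ B, (∑ x, ∑ y,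
      if proj G C x ≠ v ∧ proj G C' y ≠ v then ratio G x y v else 0) =
        if C' = C then innerWeight G C v else tSize G C v * tSize G C' v := by
    intro C hC C' hC'
    split_ifs with h
    · subst h
      rw [innerWeight_eq_sum hG (hBm _ hC).1 (hBm _ hC).2]
    · rw [tSize_eq_sum hG (hBm _ hC).1 (hBm _ hC).2, tSize_eq_sum hG (hBm _ hC').1 (hBm _ hC').2,
        Finset.sum_mul_sum]
      refine Finset.sum_congr rfl fun x _ => Finset.sum_congr rfl fun y _ => ?_
      by_cases hx : proj G C x = v
      · simp [hx]
      · by_cases hy : proj G C' y = v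
        · simp [hy]
        · simp [hx, hy, ratio_eq_one_of_ne hG (hBm _ hC).1 (hBm _ hC').1 (hBm _ hC).2 (hBm _ hC').2
            (Ne.symm h) hx hy]
  have h3 : ∑ x, ∑ y, ∑ C ∈ B, ∑ C' ∈ B,
        (if proj G C x ≠ v ∧ proj G C' y ≠ v then ratio G x y v else 0) =
      ∑ C ∈ B, ∑ C' ∈ B, ∑ x, ∑ y,
        (if proj G C x ≠ v ∧ proj G C' y ≠ v then ratio G x y v else 0) := by
    calc _ = ∑ x, ∑ C ∈ B, ∑ C' ∈ B, ∑ y, _ := Finset.sum_congr rfl fun x _ => by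
            rw [Finset.sum_comm]
            exact Finset.sum_congr rfl fun C _ => Finset.sum_comm
      _ = _ := by
            rw [Finset.sum_comm]
            exact Finset.sum_congr rfl fun C _ => Finset.sum_comm
  rw [h1, h3]
  refine Finset.sum_congr rfl fun C hC => ?_
  rw [Finset.sum_congr rfl (h2 C hC), ← Finset.add_sum_erase B _ hC, if_pos rfl, Finset.mul_sum]
  congr 1
  have : B.erase C = ((bicomponents G).erase C).filter (fun C' => v ∈ C') := by
    ext D; simp [hB, and_assoc]
  rw [← this]
  exact Finset.sum_congr rfl fun D hD => by rw [if_neg (Finset.ne_of_mem_erase hD)]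

/-- Betweenness centrality is the contribution of the break points plus the contributions of the
bi-components. -/
theorem bc_eq (hG : G.Connected) (v : V) :
    bc G v = bcA G v + 1 / numPairs V * ∑ C ∈ bicomponents G, innerWeight G C v := by
  have h := sum_ratio_eq hG v
  rw [Finset.sum_add_distrib] at h
  have h' : ∑ C ∈ (bicomponents G).filter (fun C => v ∈ C), innerWeight G C v =
      ∑ C ∈ bicomponents G, innerWeight G C v :=
    Finset.sum_filter_of_ne fun C hC hne => by
      by_contra hv
      exact hne (innerWeight_eq_zero hG hC hv)
  rw [h'] at h
  have hbc : bc G v = 1 / numPairs V *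
      ∑ s ∈ Finset.univ.erase v, ∑ t ∈ Finset.univ.erase v, ratio G s t v := rfl
  rw [hbc, h, bcA]
  ring

end Decomposition

/-! ### The sampler -/

theorem exists_inner_of_length_eq_two {V : Type*} {G : SimpleGraph V} (p : ShortestPath G)
    (h : p.walk.length = 2) :
    ∃ u, ∀ v, IsInner v p ↔ v = u := by
  obtain ⟨s, t, w, hw⟩ := p
  cases w with
  | nil => simp at h
  | @cons _ u _ h1 w =>
    cases w with
    | nil => simp at h
    | @cons _ u' _ h2 w =>
      cases w with
      | cons _ _ => simp at h
      | nil =>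
        refine ⟨u, fun v => ?_⟩
        simp only [IsInner, SimpleGraph.Walk.support_cons, SimpleGraph.Walk.support_nil,
          List.mem_cons, List.not_mem_nil, or_false]
        constructor
        · rintro ⟨h | h | h, h', h''⟩
          exacts [absurd h h', h, absurd h h'']
        · rintro rfl
          exact ⟨by simp, h1.ne', h2.ne⟩

section Weights

variable {V : Type*} [Fintype V] {G : SimpleGraph V} {A C : Finset V}

theorem numPairs_pos (hV : 2 ≤ Fintype.card V) : 0 < numPairs V := by
  have : (2 : ℝ) ≤ Fintype.card V := by exact_mod_cast hV
  unfold numPairs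
  nlinarith

theorem sum_erase_r (hG : G.Connected) (hC : C ∈ bicomponents G) {s : V} (hs : s ∈ C) :
    ∑ t ∈ C.erase s, r G C t = Fintype.card V - r G C s := by
  rw [← sum_r hG hC, ← Finset.add_sum_erase C _ hs]
  ring

theorem r_lt_card (hG : G.Connected) (hV : 2 ≤ Fintype.card V) (hC : C ∈ bicomponents G) {s : V}
    (hs : s ∈ C) : 0 < (Fintype.card V : ℝ) - r G C s := by
  rw [← sum_erase_r hG hC hs]
  obtain ⟨t, ht, hst⟩ := exists_adj_mem_bicomponent hG hV hC hs
  exact Finset.sum_pos (fun _ _ => r_pos _) ⟨t, Finset.mem_erase.2 ⟨hst.ne', ht⟩⟩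

theorem stageWeight_eq (hG : G.Connected) (hC : C ∈ bicomponents G) :
    stageWeight G C = bicomponentWeight G C := by
  have h : ∀ s ∈ C, r G C s * ((Fintype.card V : ℝ) - r G C s) =
      r G C s * Fintype.card V - r G C s ^ 2 := fun s _ => by ring
  rw [stageWeight, bicomponentWeight, Finset.sum_congr rfl h, Finset.sum_sub_distrib,
    ← Finset.sum_mul, sum_r hG hC]
  ring

theorem bicomponentWeight_pos (hG : G.Connected) (hV : 2 ≤ Fintype.card V)
    (hC : C ∈ bicomponents G) : 0 < bicomponentWeight G C :=
  Finset.sum_pos (fun _ hs => mul_pos (r_pos _) (r_lt_card hG hV hC hs)) (bicomponent_nonempty hC)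

theorem mem_targetBicomponents :
    C ∈ targetBicomponents G A ↔ C ∈ bicomponents G ∧ ∃ v ∈ A, v ∈ C := by
  simp only [targetBicomponents, Finset.mem_filter, Finset.Nonempty, Finset.mem_inter]
  exact and_congr_right fun _ => ⟨fun ⟨v, h1, h2⟩ => ⟨v, h2, h1⟩, fun ⟨v, h1, h2⟩ => ⟨v, h2, h1⟩⟩

theorem targetBicomponents_nonempty (hG : G.Connected) (hV : 2 ≤ Fintype.card V)
    (hA : A.Nonempty) : (targetBicomponents G A).Nonempty := by
  have : Nontrivial V := Fintype.one_lt_card_iff_nontrivial.1 hV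
  obtain ⟨a, ha⟩ := hA
  obtain ⟨u, hu⟩ := hG.preconnected.exists_adj_of_nontrivial a
  obtain ⟨C, hC, haC, -⟩ := exists_bicomponent_of_adj hu
  exact ⟨C, mem_targetBicomponents.2 ⟨hC, a, ha, haC⟩⟩

theorem sum_targetWeight_pos (hG : G.Connected) (hV : 2 ≤ Fintype.card V) (hA : A.Nonempty) :
    0 < ∑ C ∈ targetBicomponents G A, bicomponentWeight G C :=
  Finset.sum_pos (fun _ hC => bicomponentWeight_pos hG hV (mem_targetBicomponents.1 hC).1)
    (targetBicomponents_nonempty hG hV hA)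

theorem gamma_mul_eta (hG : G.Connected) (hV : 2 ≤ Fintype.card V) (hA : A.Nonempty) :
    gamma G * eta G A = 1 / numPairs V * ∑ C ∈ targetBicomponents G A, bicomponentWeight G C := by
  have h : 0 < ∑ C ∈ bicomponents G, bicomponentWeight G C := by
    refine Finset.sum_pos (fun _ hC => bicomponentWeight_pos hG hV hC) ?_
    obtain ⟨C, hC⟩ := targetBicomponents_nonempty hG hV hA
    exact ⟨C, (mem_targetBicomponents.1 hC).1⟩
  rw [gamma, eta]
  field_simp

theorem gamma_mul_eta_pos (hG : G.Connected) (hV : 2 ≤ Fintype.card V) (hA : A.Nonempty) :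
    0 < gamma G * eta G A := by
  rw [gamma_mul_eta hG hV hA]
  exact mul_pos (one_div_pos.2 (numPairs_pos hV)) (sum_targetWeight_pos hG hV hA)

/-- The probability that a given shortest path from `s` to `t` is proposed. -/
def pairProb (G : SimpleGraph V) (A : Finset V) (s t : V) : ℝ :=
  ∑ C ∈ (targetBicomponents G A).filter (fun C => s ∈ C ∧ t ∈ C \ {s}),
    q G C s t / (gamma G * eta G A) / sigma G s t

theorem proposalProb_eq (hG : G.Connected) (hV : 2 ≤ Fintype.card V) (p : ShortestPath G) :
    proposalProb G A p = pairProb G A p.src p.tgt := by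
  refine Finset.sum_congr rfl fun C hC => ?_
  rw [Finset.mem_filter] at hC
  have hC' := (mem_targetBicomponents.1 hC.1).1
  have h1 : stageWeight G C ≠ 0 := by
    rw [stageWeight_eq hG hC']; exact (bicomponentWeight_pos hG hV hC').ne'
  have h2 := (r_lt_card hG hV hC' hC.2.1).ne'
  have h3 := (numPairs_pos hV).ne'
  rw [q]
  field_simp

theorem pairProb_nonneg (hG : G.Connected) (hV : 2 ≤ Fintype.card V) (hA : A.Nonempty) (s t : V) :
    0 ≤ pairProb G A s t := by
  refine Finset.sum_nonneg fun C _ => ?_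
  have h1 := gamma_mul_eta_pos hG hV hA
  have h2 := numPairs_pos hV
  have h3 := r_pos (G := G) (C := C) s
  have h4 := r_pos (G := G) (C := C) t
  unfold q
  positivity

theorem pairProb_pos (hG : G.Connected) (hV : 2 ≤ Fintype.card V) (hA : A.Nonempty) {s t : V}
    (hst : s ≠ t) (hC : C ∈ targetBicomponents G A) (hs : s ∈ C) (ht : t ∈ C) :
    0 < pairProb G A s t := by
  have h1 := gamma_mul_eta_pos hG hV hA
  have h2 := numPairs_pos hV
  have h5 : (0 : ℝ) < sigma G s t := by exact_mod_cast sigma_pos hG s t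
  refine Finset.sum_pos (fun D _ => ?_) ⟨C, by simp [hC, hs, ht, hst.symm]⟩
  have h3 := r_pos (G := G) (C := D) s
  have h4 := r_pos (G := G) (C := D) t
  unfold q
  positivity

/-- Sums over shortest paths, grouped by end points. -/
theorem sum_shortestPath (F : V → V → ℝ) (f : ShortestPath G → ℝ) :
    ∑ p, F p.src p.tgt * f p =
      ∑ s, ∑ t, F s t * ∑ p with p.src = s ∧ p.tgt = t, f p := by
  rw [← Finset.sum_fiberwise (s := Finset.univ) (fun p : ShortestPath G => p.src)]
  refine Finset.sum_congr rfl fun s _ => ?_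
  rw [← Finset.sum_fiberwise (s := Finset.filter _ _) (fun p : ShortestPath G => p.tgt)]
  refine Finset.sum_congr rfl fun t _ => ?_
  rw [Finset.filter_filter, Finset.mul_sum]
  refine Finset.sum_congr rfl fun p hp => ?_
  rw [Finset.mem_filter] at hp
  rw [hp.2.1, hp.2.2]

theorem sum_pairProb (f : V → V → ℝ) :
    ∑ s, ∑ t, pairProb G A s t * f s t =
      ∑ C ∈ targetBicomponents G A, ∑ s ∈ C, ∑ t ∈ C.erase s,
        q G C s t / (gamma G * eta G A) / sigma G s t * f s t := by
  have h : ∀ s t, pairProb G A s t * f s t = ∑ C ∈ targetBicomponents G A,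
      if s ∈ C then if t ∈ C.erase s then
        q G C s t / (gamma G * eta G A) / sigma G s t * f s t else 0 else 0 := by
    intro s t
    rw [pairProb, Finset.sum_filter, Finset.sum_mul]
    refine Finset.sum_congr rfl fun C _ => ?_
    rw [← ite_and, ite_mul, zero_mul, Finset.sdiff_singleton_eq_erase]
  simp only [h]
  calc _ = ∑ s, ∑ C ∈ targetBicomponents G A, ∑ t, _ :=
        Finset.sum_congr rfl fun s _ => Finset.sum_comm
    _ = ∑ C ∈ targetBicomponents G A, ∑ s, ∑ t, _ := Finset.sum_comm
    _ = _ := by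
        refine Finset.sum_congr rfl fun C _ => ?_
        rw [← Finset.univ_inter C, ← Finset.sum_ite_mem, Finset.univ_inter]
        refine Finset.sum_congr rfl fun s _ => ?_
        split_ifs
        · rw [Finset.sum_ite_mem, Finset.univ_inter]
        · exact Finset.sum_const_zero

theorem sum_proposalProb_mul (hG : G.Connected) (hV : 2 ≤ Fintype.card V)
    (f : ShortestPath G → ℝ) :
    ∑ p, proposalProb G A p * f p =
      ∑ C ∈ targetBicomponents G A, ∑ s ∈ C, ∑ t ∈ C.erase s,
        q G C s t / (gamma G * eta G A) / sigma G s t *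
          ∑ p with p.src = s ∧ p.tgt = t, f p := by
  simp only [proposalProb_eq hG hV]
  rw [sum_shortestPath, sum_pairProb]

theorem sum_proposalProb (hG : G.Connected) (hV : 2 ≤ Fintype.card V) (hA : A.Nonempty) :
    ∑ p, proposalProb G A p = 1 := by
  have h := sum_proposalProb_mul (A := A) hG hV fun _ => 1
  simp only [mul_one] at h
  rw [h]
  have hk := gamma_mul_eta_pos hG hV hA
  have h2 : ∀ C ∈ targetBicomponents G A, (∑ s ∈ C, ∑ t ∈ C.erase s,
      q G C s t / (gamma G * eta G A) / sigma G s t *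
        ∑ p : ShortestPath G with p.src = s ∧ p.tgt = t, (1 : ℝ)) =
      1 / numPairs V * bicomponentWeight G C / (gamma G * eta G A) := by
    intro C hC
    have hC' := (mem_targetBicomponents.1 hC).1
    rw [bicomponentWeight, Finset.mul_sum, Finset.sum_div]
    refine Finset.sum_congr rfl fun s hs => ?_
    rw [← sum_erase_r hG hC' hs, Finset.mul_sum, Finset.mul_sum, Finset.sum_div]
    refine Finset.sum_congr rfl fun t _ => ?_
    have hσ : (∑ p : ShortestPath G with p.src = s ∧ p.tgt = t, (1 : ℝ)) = sigma G s t := by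
      simp [sigma]
    have hσ' : (sigma G s t : ℝ) ≠ 0 := by exact_mod_cast (sigma_pos hG s t).ne'
    rw [hσ, div_mul_cancel₀ _ hσ', q]
  rw [Finset.sum_congr rfl h2, ← Finset.sum_div, ← Finset.mul_sum, ← gamma_mul_eta hG hV hA,
    div_self hk.ne']

theorem sum_g (s t v : V) :
    ∑ p : ShortestPath G with p.src = s ∧ p.tgt = t, g v p =
      if s ≠ v ∧ t ≠ v then (sigmaThrough G s t v : ℝ) else 0 := by
  rw [sigmaThrough]
  simp only [g, Finset.sum_boole, Finset.filter_filter]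
  split_ifs with h
  · congr 2
    ext p
    rw [Finset.mem_filter, Finset.mem_filter]
    constructor
    · rintro ⟨-, ⟨rfl, rfl⟩, h1, -⟩; exact ⟨Finset.mem_univ _, rfl, rfl, h1⟩
    · rintro ⟨-, rfl, rfl, h1⟩
      exact ⟨Finset.mem_univ _, ⟨rfl, rfl⟩, h1, h.1.symm, h.2.symm⟩
  · rw [Nat.cast_eq_zero, Finset.card_eq_zero, Finset.filter_eq_empty_iff]
    rintro p - ⟨⟨rfl, rfl⟩, -, h1, h2⟩
    exact h ⟨h1.symm, h2.symm⟩

/-- The risk of the hypothesis of a target node over the whole sample space. -/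
theorem bc_eq_sum_proposalProb (hG : G.Connected) (hV : 2 ≤ Fintype.card V) {v : V} (hv : v ∈ A) :
    bc G v = bcA G v + gamma G * eta G A * ∑ p, proposalProb G A p * g v p := by
  have hA : A.Nonempty := ⟨v, hv⟩
  have hk := (gamma_mul_eta_pos hG hV hA).ne'
  rw [bc_eq hG, sum_proposalProb_mul hG hV, Finset.mul_sum, Finset.mul_sum]
  have hsub : targetBicomponents G A ⊆ bicomponents G := Finset.filter_subset _ _
  rw [← Finset.sum_subset hsub]
  · congr 1
    refine Finset.sum_congr rfl fun C hC => ?_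
    rw [innerWeight, Finset.mul_sum, Finset.mul_sum]
    refine Finset.sum_congr rfl fun s hs => ?_
    rw [← Finset.add_sum_erase C _ hs]
    have h0 : (if s ≠ v ∧ s ≠ v then ratio G s s v else 0) = 0 := by
      split_ifs with h
      · refine ratio_eq_zero hG ?_
        have := hG.pos_dist_of_ne h.1
        rw [SimpleGraph.dist_self]
        omega
      · rfl
    rw [h0, mul_zero, zero_add, Finset.mul_sum, Finset.mul_sum, Finset.mul_sum]
    refine Finset.sum_congr rfl fun t _ => ?_
    rw [sum_g, ratio, q]
    have h3 := (numPairs_pos hV).ne'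
    generalize gamma G * eta G A = k at hk ⊢
    split_ifs
    · field_simp
    · simp
  · intro C hC hCA
    rw [innerWeight_eq_zero hG hC fun hvC => hCA (mem_targetBicomponents.2 ⟨hC, v, hv, hvC⟩),
      mul_zero]

theorem sigma_of_adj {s t : V} (h : G.Adj s t) : sigma G s t = 1 := by
  rw [sigma_eq_natCard, SimpleGraph.dist_eq_one_iff_adj.2 h, Nat.card_eq_one_iff_unique]
  refine ⟨⟨?_⟩, ⟨⟨h.toWalk, by simp⟩⟩⟩
  rintro ⟨p, hp⟩ ⟨p', hp'⟩
  have key : ∀ {w : G.Walk s t}, w.length = 1 → w = h.toWalk := by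
    intro w hw
    cases w with
    | nil => simp at hw
    | cons h' w' =>
      cases w' with
      | nil => rfl
      | cons _ _ => simp at hw
  exact Subtype.ext ((key hp).trans (key hp').symm)

theorem sigmaThrough_of_dist_eq_two (hG : G.Connected) {s t v : V} (hd : G.dist s t = 2)
    (hs : s ≠ v) (ht : t ≠ v) :
    sigmaThrough G s t v = if G.Adj s v ∧ G.Adj v t then 1 else 0 := by
  split_ifs with h
  · rw [sigmaThrough_eq_mul, sigma_of_adj h.1, sigma_of_adj h.2]
    rw [SimpleGraph.dist_eq_one_iff_adj.2 h.1, SimpleGraph.dist_eq_one_iff_adj.2 h.2, hd]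
  · refine sigmaThrough_eq_zero hG fun e => h ?_
    have h1 := hG.pos_dist_of_ne hs
    have h2 := hG.pos_dist_of_ne ht.symm
    exact ⟨SimpleGraph.dist_eq_one_iff_adj.1 (by omega),
      SimpleGraph.dist_eq_one_iff_adj.1 (by omega)⟩

/-- The indicator that `v` is the inner node of a path of length two. -/
def twoHop (v : V) (p : ShortestPath G) : ℝ := if p.walk.length = 2 then g v p else 0

theorem sum_twoHop (hG : G.Connected) (s t v : V) :
    ∑ p : ShortestPath G with p.src = s ∧ p.tgt = t, twoHop v p =
      if G.dist s t = 2 ∧ G.Adj s v ∧ G.Adj v t then 1 else 0 := by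
  have h : ∀ p ∈ (Finset.univ.filter fun p : ShortestPath G => p.src = s ∧ p.tgt = t),
      twoHop v p = (if G.dist s t = 2 then 1 else 0) * g v p := by
    intro p hp
    rw [Finset.mem_filter] at hp
    obtain ⟨-, rfl, rfl⟩ := hp
    rw [twoHop, p.isShortest, ite_mul, one_mul, zero_mul]
  rw [Finset.sum_congr rfl h, ← Finset.mul_sum, sum_g]
  by_cases hd : G.dist s t = 2
  · by_cases hst : s ≠ v ∧ t ≠ v
    · rw [if_pos hst, sigmaThrough_of_dist_eq_two hG hd hst.1 hst.2]
      simp [hd]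
    · rw [if_neg hst, mul_zero, if_neg]
      rintro ⟨-, h1, h2⟩
      exact hst ⟨h1.ne, h2.ne'⟩
  · simp [hd]

theorem sum_univ_twoHop (p : ShortestPath G) :
    ∑ v, twoHop v p = if p.walk.length = 2 then 1 else 0 := by
  unfold twoHop
  split_ifs with h
  · obtain ⟨u, hu⟩ := exists_inner_of_length_eq_two p h
    simp [g, hu]
  · simp

theorem twoHopCount_eq_sigma (hG : G.Connected) {s t : V} (hd : G.dist s t = 2) :
    twoHopCount G s t = sigma G s t := by
  have h : ∑ v, ∑ p : ShortestPath G with p.src = s ∧ p.tgt = t, twoHop v p =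
      (twoHopCount G s t : ℝ) := by
    simp only [sum_twoHop hG, hd, true_and, Finset.sum_boole, twoHopCount]
  rw [Finset.sum_comm] at h
  have h' : ∀ p ∈ (Finset.univ.filter fun p : ShortestPath G => p.src = s ∧ p.tgt = t),
      ∑ v, twoHop v p = 1 := by
    intro p hp
    rw [Finset.mem_filter] at hp
    obtain ⟨-, rfl, rfl⟩ := hp
    rw [sum_univ_twoHop, p.isShortest, if_pos hd]
  rw [Finset.sum_congr rfl h'] at h
  simp only [Finset.sum_const, nsmul_eq_mul, mul_one] at h
  exact_mod_cast h.symm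

theorem dist_eq_two_iff {s t v : V} (h1 : G.Adj s v) (h2 : G.Adj v t) :
    G.dist s t = 2 ↔ t ∈ twoHopSet G s := by
  have hc : 0 < twoHopCount G s t := Finset.card_pos.2 ⟨v, by simp [h1, h2]⟩
  have hr : G.Reachable s t := ⟨.cons h1 (.cons h2 .nil)⟩
  have hle : G.dist s t ≤ 2 := SimpleGraph.dist_le (.cons h1 (.cons h2 .nil))
  simp only [twoHopSet, Finset.mem_filter, Finset.mem_univ, true_and, hc, and_true]
  constructor
  · intro hd
    refine ⟨?_, fun h => ?_⟩
    · rintro rfl; simp at hd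
    · rw [SimpleGraph.dist_eq_one_iff_adj.2 h] at hd; omega
  · rintro ⟨hne, hadj⟩
    have h0 : G.dist s t ≠ 0 := fun h => hne (hr.dist_eq_zero_iff.1 h).symm
    have h1 : G.dist s t ≠ 1 := fun h => hadj (SimpleGraph.dist_eq_one_iff_adj.1 h)
    omega

/-- The exact algorithm computes the weight of the two-hop paths through `v`. -/
theorem exactRisk_eq (hG : G.Connected) (hV : 2 ≤ Fintype.card V) {v : V} (hv : v ∈ A) :
    exactRisk G A v = ∑ p, proposalProb G A p * twoHop v p := by
  rw [sum_proposalProb_mul hG hV]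
  have hsub : targetBicomponents G A ⊆ bicomponents G := Finset.filter_subset _ _
  rw [exactRisk, ← Finset.sum_subset hsub]
  · refine Finset.sum_congr rfl fun C _ => ?_
    have hB : nbrsOfTargets G A ∩ C ⊆ C := Finset.inter_subset_right
    rw [← Finset.sum_subset hB]
    · refine Finset.sum_congr rfl fun s hs => ?_
      simp only [sum_twoHop hG, mul_ite, mul_one, mul_zero]
      rw [← Finset.sum_filter]
      refine Finset.sum_congr ?_ fun t ht => ?_
      · ext t
        simp only [Finset.mem_filter, Finset.mem_inter, Finset.mem_erase]
        constructor
        · rintro ⟨⟨⟨-, htC⟩, ht⟩, h1, h2⟩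
          refine ⟨⟨?_, htC⟩, (dist_eq_two_iff h1 h2).2 ht, h1, h2⟩
          simp only [twoHopSet, Finset.mem_filter] at ht
          exact ht.2.1
        · rintro ⟨⟨-, htC⟩, hd, h1, h2⟩
          refine ⟨⟨⟨?_, htC⟩, (dist_eq_two_iff h1 h2).1 hd⟩, h1, h2⟩
          simp only [nbrsOfTargets, Finset.mem_filter, Finset.mem_univ, true_and]
          exact ⟨v, hv, h2⟩
      · rw [twoHopCount_eq_sigma hG (Finset.mem_filter.1 ht).2.1]
        ring
    · intro s hs hsB
      refine Finset.sum_eq_zero fun t _ => ?_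
      rw [sum_twoHop hG, if_neg, mul_zero]
      rintro ⟨-, h1, -⟩
      refine hsB (Finset.mem_inter.2 ⟨?_, hs⟩)
      simp only [nbrsOfTargets, Finset.mem_filter, Finset.mem_univ, true_and]
      exact ⟨v, hv, h1.symm⟩
  · intro C hC hCA
    refine Finset.sum_eq_zero fun s hs => ?_
    rw [Finset.filter_false_of_mem, Finset.sum_empty]
    rintro t ht ⟨h1, h2⟩
    simp only [Finset.mem_inter] at hs ht
    have hd := (dist_eq_two_iff h1 h2).2 ht.2
    have hvC : v ∉ C := fun h => hCA (mem_targetBicomponents.2 ⟨hC, v, hv, h⟩)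
    have h0 := ratio_eq_zero_of_notMem hG hC hs.2 ht.1.2 hvC
    rw [ratio, sigmaThrough_of_dist_eq_two hG hd h1.ne h2.ne', if_pos ⟨h1, h2⟩] at h0
    have := sigma_pos hG s t
    rw [div_eq_zero_iff] at h0
    rcases h0 with h0 | h0
    · simp at h0
    · exact this.ne' (by exact_mod_cast h0)

theorem mem_sampleSpace_of_proposalProb_ne_zero (hG : G.Connected) (hV : 2 ≤ Fintype.card V)
    {p : ShortestPath G} (h : proposalProb G A p ≠ 0) : p ∈ sampleSpace G A := by
  rw [proposalProb_eq hG hV, pairProb] at h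
  obtain ⟨C, hC, -⟩ := Finset.exists_ne_zero_of_sum_ne_zero h
  simp only [Finset.mem_filter, Finset.mem_sdiff, Finset.mem_singleton] at hC
  simp only [sampleSpace, Finset.mem_filter, Finset.mem_univ, true_and]
  exact ⟨Ne.symm hC.2.2.2, C, hC.1, hC.2.1, hC.2.2.1⟩

theorem proposalProb_mul_twoHop (hG : G.Connected) (hV : 2 ≤ Fintype.card V) {v : V} (hv : v ∈ A)
    (p : ShortestPath G) : proposalProb G A p * twoHop v p =
      if p ∈ exactSpace G A then proposalProb G A p * g v p else 0 := by
  by_cases h0 : proposalProb G A p = 0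
  · simp [h0]
  have hs := mem_sampleSpace_of_proposalProb_ne_zero hG hV h0
  unfold twoHop g
  by_cases hl : p.walk.length = 2
  · by_cases hi : IsInner v p
    · rw [if_pos hl, if_pos hi, if_pos]
      exact Finset.mem_filter.2 ⟨hs, hl, v, hv, hi⟩
    · simp [hi]
  · rw [if_neg hl, mul_zero, if_neg]
    exact fun h => hl (Finset.mem_filter.1 h).2.1

theorem exactWeight_eq (hG : G.Connected) (hV : 2 ≤ Fintype.card V) :
    exactWeight G A = rejectProb G A := by
  have h : ∀ v ∈ A, exactRisk G A v = ∑ p ∈ exactSpace G A, proposalProb G A p * g v p := by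
    intro v hv
    rw [exactRisk_eq hG hV hv]
    simp only [proposalProb_mul_twoHop hG hV hv]
    rw [Finset.sum_ite_mem, Finset.univ_inter]
  rw [exactWeight, Finset.sum_congr rfl h, Finset.sum_comm, rejectProb]
  refine Finset.sum_congr rfl fun p hp => ?_
  obtain ⟨-, hl, v, hv, hi⟩ := Finset.mem_filter.1 hp
  obtain ⟨u, hu⟩ := exists_inner_of_length_eq_two p hl
  have : v = u := (hu v).1 hi
  subst this
  simp [g, hu, hv]

theorem proposalProb_nonneg (hG : G.Connected) (hV : 2 ≤ Fintype.card V) (hA : A.Nonempty)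
    (p : ShortestPath G) : 0 ≤ proposalProb G A p := by
  rw [proposalProb_eq hG hV]
  exact pairProb_nonneg hG hV hA _ _

theorem sum_compl_exactSpace (hG : G.Connected) (hV : 2 ≤ Fintype.card V) (hA : A.Nonempty) :
    ∑ p ∈ (exactSpace G A)ᶜ, proposalProb G A p = 1 - rejectProb G A := by
  rw [← sum_proposalProb hG hV hA, rejectProb,
    ← Finset.sum_add_sum_compl (exactSpace G A) (proposalProb G A)]
  ring

theorem rejectProb_lt_one (hG : G.Connected) (hV : 2 ≤ Fintype.card V) (hA : A.Nonempty) :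
    rejectProb G A < 1 := by
  rw [← sub_pos, ← sum_compl_exactSpace hG hV hA]
  obtain ⟨C, hC⟩ := targetBicomponents_nonempty hG hV hA
  have hC' := (mem_targetBicomponents.1 hC).1
  obtain ⟨s, hs⟩ := bicomponent_nonempty hC'
  obtain ⟨t, ht, hst⟩ := exists_adj_mem_bicomponent hG hV hC' hs
  let p : ShortestPath G :=
    ⟨s, t, hst.toWalk, by simp [SimpleGraph.dist_eq_one_iff_adj.2 hst]⟩
  refine Finset.sum_pos' (fun p _ => proposalProb_nonneg hG hV hA p) ⟨p, ?_, ?_⟩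
  · rw [Finset.mem_compl]
    intro h
    have := (Finset.mem_filter.1 h).2.1
    simp [p] at this
  · rw [proposalProb_eq hG hV]
    exact pairProb_pos hG hV hA hst.ne hC hs ht

theorem rejectProb_nonneg (hG : G.Connected) (hV : 2 ≤ Fintype.card V) (hA : A.Nonempty) :
    0 ≤ rejectProb G A :=
  Finset.sum_nonneg fun p _ => proposalProb_nonneg hG hV hA p

/-- The output distribution of the sampler is the proposal distribution conditioned on not being
rejected. -/
theorem genProb_eq (hG : G.Connected) (hV : 2 ≤ Fintype.card V) (hA : A.Nonempty)
    (p : ShortestPath G) : genProb G A p =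
      if p ∈ exactSpace G A then 0 else proposalProb G A p / (1 - rejectProb G A) := by
  rw [genProb, tsum_mul_right,
    tsum_geometric_of_lt_one (rejectProb_nonneg hG hV hA) (rejectProb_lt_one hG hV hA),
    div_eq_inv_mul]

theorem genProb_nonneg (hG : G.Connected) (hV : 2 ≤ Fintype.card V) (hA : A.Nonempty)
    (p : ShortestPath G) : 0 ≤ genProb G A p := by
  rw [genProb_eq hG hV hA]
  split_ifs
  · exact le_rfl
  · exact div_nonneg (proposalProb_nonneg hG hV hA p)
      (sub_nonneg.2 (rejectProb_lt_one hG hV hA).le)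

theorem sum_genProb (hG : G.Connected) (hV : 2 ≤ Fintype.card V) (hA : A.Nonempty) :
    ∑ p, genProb G A p = 1 := by
  have h := sub_pos.2 (rejectProb_lt_one hG hV hA)
  rw [← Finset.sum_add_sum_compl (exactSpace G A), Finset.sum_eq_zero, zero_add,
    Finset.sum_congr rfl (g := fun p => proposalProb G A p / (1 - rejectProb G A)),
    ← Finset.sum_div, sum_compl_exactSpace hG hV hA, div_self h.ne']
  · intro p hp
    rw [genProb_eq hG hV hA, if_neg (Finset.mem_compl.1 hp)]
  · intro p hp
    rw [genProb_eq hG hV hA, if_pos hp]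

theorem genProb_eq_zero (hG : G.Connected) (hV : 2 ≤ Fintype.card V) (hA : A.Nonempty)
    {p : ShortestPath G} (hp : p ∉ approxSpace G A) : genProb G A p = 0 := by
  rw [genProb_eq hG hV hA]
  split_ifs with h
  · rfl
  · rw [div_eq_zero_iff]
    left
    by_contra h0
    exact hp (Finset.mem_sdiff.2 ⟨mem_sampleSpace_of_proposalProb_ne_zero hG hV h0, h⟩)

theorem one_sub_exactWeight_pos (hG : G.Connected) (hV : 2 ≤ Fintype.card V) (hA : A.Nonempty) :
    0 < 1 - exactWeight G A := by
  rw [exactWeight_eq hG hV]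
  exact sub_pos.2 (rejectProb_lt_one hG hV hA)

/-- Betweenness centrality in terms of the exact part and the risk under the sampler. -/
theorem bc_eq_risk (hG : G.Connected) (hV : 2 ≤ Fintype.card V) {v : V} (hv : v ∈ A) :
    bc G v = bcA G v + gamma G * eta G A *
      (exactRisk G A v + (1 - exactWeight G A) * ∑ p, genProb G A p * g v p) := by
  have hA : A.Nonempty := ⟨v, hv⟩
  have hl := one_sub_exactWeight_pos hG hV hA
  rw [bc_eq_sum_proposalProb hG hV hv, exactRisk_eq hG hV hv,
    Finset.mul_sum (s := Finset.univ) (a := 1 - exactWeight G A), ← Finset.sum_add_distrib]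
  congr 2
  refine Finset.sum_congr rfl fun p _ => ?_
  rw [proposalProb_mul_twoHop hG hV hv, genProb_eq hG hV hA, ← exactWeight_eq hG hV]
  split_ifs
  · ring
  · field_simp
    ring

end Weights

/-! ### Probabilities on finite types -/

section FiniteProb

variable {Z : Type*} [Fintype Z] {w : Z → ℝ}

/-- `w` is a probability mass function on a finite type. -/
structure IsDist (w : Z → ℝ) : Prop where
  nonneg : ∀ z, 0 ≤ w z
  sum_eq_one : ∑ z, w z = 1

/-- The `w`-weight of an event. -/
def prob (w : Z → ℝ) (E : Z → Prop) : ℝ := ∑ z, if E z then w z else 0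

theorem prob_nonneg (hw : IsDist w) (E : Z → Prop) : 0 ≤ prob w E :=
  Finset.sum_nonneg fun z _ => by split_ifs <;> simp [hw.nonneg z]

theorem prob_mono (hw : IsDist w) {E F : Z → Prop} (h : ∀ z, w z ≠ 0 → E z → F z) :
    prob w E ≤ prob w F := by
  refine Finset.sum_le_sum fun z _ => ?_
  by_cases h0 : w z = 0
  · simp [h0]
  · split_ifs with h1 h2 h2
    · exact le_rfl
    · exact absurd (h z h0 h1) h2
    · exact hw.nonneg z
    · exact le_rfl

theorem prob_or_le (hw : IsDist w) (E F : Z → Prop) :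
    prob w (fun z => E z ∨ F z) ≤ prob w E + prob w F := by
  rw [prob, prob, prob, ← Finset.sum_add_distrib]
  refine Finset.sum_le_sum fun z _ => ?_
  have := hw.nonneg z
  by_cases h1 : E z <;> by_cases h2 : F z <;> simp [h1, h2, this]

theorem prob_exists_le (hw : IsDist w) {κ : Type*} (s : Finset κ) (E : κ → Z → Prop) :
    prob w (fun z => ∃ k ∈ s, E k z) ≤ ∑ k ∈ s, prob w (E k) := by
  induction s using Finset.induction_on with
  | empty => simp [prob]
  | insert k s hk ih =>
    rw [Finset.sum_insert hk]
    refine le_trans (prob_mono hw fun z _ h => ?_) ((prob_or_le hw _ _).trans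
      (add_le_add_right ih _))
    obtain ⟨j, hj, hE⟩ := h
    rcases Finset.mem_insert.1 hj with rfl | hj
    · exact Or.inl hE
    · exact Or.inr ⟨j, hj, hE⟩

theorem prob_not (hw : IsDist w) (E : Z → Prop) : prob w (fun z => ¬ E z) = 1 - prob w E := by
  rw [← hw.sum_eq_one, prob, prob, ← Finset.sum_sub_distrib]
  exact Finset.sum_congr rfl fun z _ => by by_cases h : E z <;> simp [h]

/-- Markov's inequality. -/
theorem prob_le_sum (hw : IsDist w) {E : Z → Prop} {F : Z → ℝ} (h0 : ∀ z, 0 ≤ F z)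
    (h1 : ∀ z, E z → 1 ≤ F z) : prob w E ≤ ∑ z, w z * F z := by
  refine Finset.sum_le_sum fun z _ => ?_
  have := hw.nonneg z
  split_ifs with h
  · exact le_mul_of_one_le_right this (h1 z h)
  · exact mul_nonneg this (h0 z)

/-- The weights of independent families. -/
def prodW (w : Z → ℝ) (ι : Type*) [Fintype ι] (x : ι → Z) : ℝ := ∏ i, w (x i)

theorem sum_prodW_mul_prod (w : Z → ℝ) {ι : Type*} [Fintype ι] [DecidableEq ι] (F : ι → Z → ℝ) :
    ∑ x : ι → Z, prodW w ι x * ∏ i, F i (x i) = ∏ i, ∑ z, w z * F i z := by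
  simp only [prodW, ← Finset.prod_mul_distrib]
  rw [Finset.prod_univ_sum, Fintype.piFinset_univ]

theorem IsDist.prodW (hw : IsDist w) (ι : Type*) [Fintype ι] [DecidableEq ι] : IsDist (prodW w ι) where
  nonneg _ := Finset.prod_nonneg fun _ _ => hw.nonneg _
  sum_eq_one := by
    have := sum_prodW_mul_prod w (ι := ι) fun _ _ => 1
    simpa [hw.sum_eq_one] using this

end FiniteProb

/-! ### Chernoff bounds for Bernoulli averages -/

section Chernoff

theorem log_le_half_sub_inv {t : ℝ} (ht : 1 ≤ t) : Real.log t ≤ (t - t⁻¹) / 2 := by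
  have h := Real.self_le_sinh_iff.2 (Real.log_nonneg ht)
  rwa [Real.sinh_log (by linarith)] at h

theorem exists_exponential_tilt {p q : ℝ} (hp : 0 ≤ p) (hpq : p < q) (hq : q ≤ 1) :
    ∃ a b : ℝ, b ≤ a ∧ Real.exp (-(q * a + (1 - q) * b)) *
      (p * Real.exp a + (1 - p) * Real.exp b) ≤
        Real.exp (-((q - p) ^ 2 / (2 * (q * (1 - q) + (q - p))))) := by
  rcases hp.eq_or_lt with rfl | hp
  · refine ⟨1 / 2, 0, by norm_num, ?_⟩
    have : q * (1 / 2) ≥ (q - 0) ^ 2 / (2 * (q * (1 - q) + (q - 0))) := by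
      rw [ge_iff_le, div_le_iff₀ (by nlinarith)]
      nlinarith [mul_nonneg (mul_nonneg hpq.le hpq.le) (sub_nonneg.2 hq)]
    simpa using this
  rcases hq.eq_or_lt with rfl | hq
  · refine ⟨Real.log 2, 0, Real.log_nonneg (by norm_num), ?_⟩
    have h1 : (1 - p) ^ 2 / (2 * (1 * (1 - 1) + (1 - p))) = (1 - p) / 2 := by
      have : 0 < 1 - p := by linarith
      rw [div_eq_div_iff (by positivity) two_ne_zero]
      ring
    have h2 := Real.add_one_le_exp (-((1 - p) / 2))
    rw [h1, Real.exp_log two_pos, sub_self, zero_mul, add_zero, one_mul, Real.exp_neg,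
      Real.exp_log two_pos, Real.exp_zero]
    linarith
  · have hp1 : 0 < 1 - p := by linarith
    have hq1 : 0 < 1 - q := by linarith
    have hq0 : 0 < q := by linarith
    have e1 : 0 < q / p := by positivity
    have e2 : 0 < (1 - q) / (1 - p) := by positivity
    refine ⟨Real.log (q / p), Real.log ((1 - q) / (1 - p)), ?_, ?_⟩
    · refine Real.log_le_log e2 ?_
      rw [div_le_div_iff₀ hp1 hp]
      nlinarith
    · have hs : p * (q / p) + (1 - p) * ((1 - q) / (1 - p)) = 1 := by
        field_simp
        ring
      rw [Real.exp_log e1, Real.exp_log e2, hs, mul_one, Real.exp_le_exp, neg_le_neg_iff]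
      have l1 : 2 * (q - p) / (p + q) ≤ Real.log (q / p) := by
        have := Real.le_log_one_add_of_nonneg (x := (q - p) / p) (by
          exact div_nonneg (by linarith) hp.le)
        have e : 1 + (q - p) / p = q / p := by field_simp; ring
        have e' : 2 * ((q - p) / p) / ((q - p) / p + 2) = 2 * (q - p) / (p + q) := by
          have : (q - p) / p + 2 = (p + q) / p := by field_simp; ring
          rw [this]
          field_simp
        rwa [e, e'] at this
      have l2 : Real.log ((1 - p) / (1 - q)) ≤
          ((1 - p) / (1 - q) - ((1 - p) / (1 - q))⁻¹) / 2 :=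
        log_le_half_sub_inv (by rw [le_div_iff₀ hq1]; linarith)
      have l3 : Real.log ((1 - q) / (1 - p)) = -Real.log ((1 - p) / (1 - q)) := by
        rw [← Real.log_inv, inv_div]
      have m1 : q * (2 * (q - p) / (p + q)) ≤ q * Real.log (q / p) :=
        mul_le_mul_of_nonneg_left l1 hq0.le
      have m2 := mul_le_mul_of_nonneg_left l2 hq1.le
      have f1 : (q - p) + (q - p) ^ 2 / (2 * q) ≤ q * (2 * (q - p) / (p + q)) := by
        have : q * (2 * (q - p) / (p + q)) = (q - p) + (q - p) ^ 2 / (p + q) := by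
          field_simp
          ring
        rw [this]
        have : (q - p) ^ 2 / (2 * q) ≤ (q - p) ^ 2 / (p + q) :=
          div_le_div_of_nonneg_left (sq_nonneg _) (by linarith) (by linarith)
        linarith
      have f2 : (1 - q) * (((1 - p) / (1 - q) - ((1 - p) / (1 - q))⁻¹) / 2) =
          (q - p) - (q - p) ^ 2 / (2 * (1 - p)) := by
        field_simp
        ring
      have f3 : (q - p) ^ 2 / (2 * (q * (1 - q) + (q - p))) ≤
          (q - p) ^ 2 / (2 * q) + (q - p) ^ 2 / (2 * (1 - p)) := by
        have : (q - p) ^ 2 / (2 * q) + (q - p) ^ 2 / (2 * (1 - p)) =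
            (q - p) ^ 2 * (1 + (q - p)) / (2 * (q * (1 - p))) := by
          field_simp
          ring
        rw [this, div_le_div_iff₀ (by nlinarith) (by positivity)]
        have h1 : q * (1 - p) ≤ q * (1 - q) + (q - p) := by nlinarith
        have h2 : q * (1 - p) ≤ (1 + (q - p)) * (q * (1 - q) + (q - p)) :=
          h1.trans (le_mul_of_one_le_left (by nlinarith) (by linarith))
        linarith [mul_le_mul_of_nonneg_left h2 (sq_nonneg (q - p))]
      rw [l3]
      linarith

variable {Z : Type*} [Fintype Z] {w : Z → ℝ}

/-- The mean of `φ` under the weights `w`. -/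
def expect (w : Z → ℝ) (φ : Z → ℝ) : ℝ := ∑ z, w z * φ z

theorem expect_nonneg (hw : IsDist w) {φ : Z → ℝ} (hφ : ∀ z, φ z = 0 ∨ φ z = 1) :
    0 ≤ expect w φ :=
  Finset.sum_nonneg fun z _ => mul_nonneg (hw.nonneg z) (by rcases hφ z with h | h <;> simp [h])

theorem expect_one_sub (hw : IsDist w) (φ : Z → ℝ) :
    expect w (fun z => 1 - φ z) = 1 - expect w φ := by
  simp only [expect, mul_sub, mul_one, Finset.sum_sub_distrib, hw.sum_eq_one]

theorem chernoff (hw : IsDist w) {φ : Z → ℝ} (hφ : ∀ z, φ z = 0 ∨ φ z = 1) {q : ℝ}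
    (hpq : expect w φ < q) (hq : q ≤ 1) (N : ℕ) :
    prob (prodW w (Fin N)) (fun x => N * q ≤ ∑ i, φ (x i)) ≤
      Real.exp (-(N * ((q - expect w φ) ^ 2 / (2 * (q * (1 - q) + (q - expect w φ)))))) := by
  obtain ⟨a, b, hab, h⟩ := exists_exponential_tilt (expect_nonneg hw hφ) hpq hq
  set p := expect w φ with hp
  have h1 : ∑ z, w z * Real.exp (φ z * a + (1 - φ z) * b - (q * a + (1 - q) * b)) =
      Real.exp (-(q * a + (1 - q) * b)) * (p * Real.exp a + (1 - p) * Real.exp b) := by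
    rw [← expect_one_sub hw, hp, expect, expect, Finset.sum_mul, Finset.sum_mul,
      ← Finset.sum_add_distrib, Finset.mul_sum]
    refine Finset.sum_congr rfl fun z _ => ?_
    rw [sub_eq_neg_add, Real.exp_add]
    rcases hφ z with h | h <;> simp [h] <;> ring
  have h2 : prob (prodW w (Fin N)) (fun x => N * q ≤ ∑ i, φ (x i)) ≤
      ∑ x : Fin N → Z, prodW w (Fin N) x *
        ∏ i, Real.exp (φ (x i) * a + (1 - φ (x i)) * b - (q * a + (1 - q) * b)) := by
    refine prob_le_sum (hw.prodW (Fin N)) (fun x => Finset.prod_nonneg fun _ _ => (Real.exp_pos _).le)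
      fun x hx => ?_
    rw [← Real.exp_sum, Real.one_le_exp_iff]
    have : ∑ i, (φ (x i) * a + (1 - φ (x i)) * b - (q * a + (1 - q) * b)) =
        (∑ i, φ (x i) - N * q) * (a - b) := by
      simp only [Finset.sum_sub_distrib, Finset.sum_add_distrib, ← Finset.sum_mul,
        Finset.sum_const, Finset.card_univ, Fintype.card_fin, nsmul_eq_mul, mul_one]
      ring
    rw [this]
    exact mul_nonneg (sub_nonneg.2 hx) (sub_nonneg.2 hab)
  refine h2.trans ?_
  rw [sum_prodW_mul_prod w (ι := Fin N) fun _ z =>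
    Real.exp (φ z * a + (1 - φ z) * b - (q * a + (1 - q) * b)), h1]
  rw [Finset.prod_const, Finset.card_univ, Fintype.card_fin]
  refine (pow_le_pow_left₀ ?_ h N).trans ?_
  · rw [← h1]
    exact Finset.sum_nonneg fun z _ => mul_nonneg (hw.nonneg z) (Real.exp_pos _).le
  · rw [← Real.exp_nat_mul, mul_neg]

/-! ### The empirical Bernstein inequality -/

/-- The empirical Bernstein error in terms of the empirical mean `m`. -/
def meanError (N : ℕ) (L m : ℝ) : ℝ :=
  √(1 / (N : ℝ) * (2 * (m * (1 - m)) * L)) + 7 * L / (3 * (N : ℝ))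

theorem prob_meanError_upper (hw : IsDist w) {φ : Z → ℝ} (hφ : ∀ z, φ z = 0 ∨ φ z = 1) {N : ℕ}
    (hN : 0 < N) {L : ℝ} (hL : 0 < L) :
    prob (prodW w (Fin N)) (fun x => meanError N L ((∑ i, φ (x i)) / N) ≤
      (∑ i, φ (x i)) / N - expect w φ) ≤ Real.exp (-L) := by
  set E : (Fin N → Z) → Prop := fun x => meanError N L ((∑ i, φ (x i)) / N) ≤
      (∑ i, φ (x i)) / N - expect w φ with hE
  have hN' : (0 : ℝ) < N := by exact_mod_cast hN
  by_cases hne : (Finset.univ.filter E).Nonempty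
  · obtain ⟨x₀, hx₀, hmin⟩ := Finset.exists_min_image _ (fun x => ∑ i, φ (x i)) hne
    have hx₀' : E x₀ := (Finset.mem_filter.1 hx₀).2
    set q := (∑ i, φ (x₀ i)) / N with hq
    set p := expect w φ with hp
    have hS : ∑ i, φ (x₀ i) = N * q := by rw [hq]; field_simp
    have hq0 : 0 ≤ q := div_nonneg (Finset.sum_nonneg fun i _ => by
      rcases hφ (x₀ i) with h | h <;> simp [h]) hN'.le
    have hq1 : q ≤ 1 := by
      rw [hq, div_le_one hN']
      calc ∑ i, φ (x₀ i) ≤ ∑ _i : Fin N, (1 : ℝ) :=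
            Finset.sum_le_sum fun i _ => by rcases hφ (x₀ i) with h | h <;> simp [h]
        _ = N := by simp
    have hv : 0 ≤ q * (1 - q) := mul_nonneg hq0 (by linarith)
    have ha : 0 < L / N := by positivity
    have hE₀ : √(2 * (L / N) * (q * (1 - q))) + 7 / 3 * (L / N) ≤ q - p := by
      have : √(2 * (L / N) * (q * (1 - q))) + 7 / 3 * (L / N) = meanError N L q := by
        rw [meanError]
        congr 1
        · congr 1; field_simp
        · field_simp
      rw [this]
      exact hx₀'
    set sq := √(2 * (L / N) * (q * (1 - q))) with hsq
    have hsq0 : 0 ≤ sq := Real.sqrt_nonneg _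
    have hsq2 : sq ^ 2 = 2 * (L / N) * (q * (1 - q)) := Real.sq_sqrt (by positivity)
    have hpq : p < q := by linarith
    have hrate : L / N ≤ (q - p) ^ 2 / (2 * (q * (1 - q) + (q - p))) := by
      rw [le_div_iff₀ (by nlinarith)]
      have h1 : (sq + 7 / 3 * (L / N)) * (sq + 1 / 3 * (L / N)) ≤ (q - p) * (q - p - 2 * (L / N)) :=
        mul_le_mul hE₀ (by linarith) (by positivity) (by linarith)
      nlinarith [mul_nonneg hsq0 ha.le, sq_nonneg (L / N)]
    calc prob (prodW w (Fin N)) E ≤ prob (prodW w (Fin N)) (fun x => N * q ≤ ∑ i, φ (x i)) := by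
          refine prob_mono (hw.prodW (Fin N)) fun x _ hx => ?_
          rw [← hS]
          exact hmin x (Finset.mem_filter.2 ⟨Finset.mem_univ _, hx⟩)
      _ ≤ _ := chernoff hw hφ hpq hq1 N
      _ ≤ _ := by
          rw [Real.exp_le_exp, neg_le_neg_iff]
          have := mul_le_mul_of_nonneg_left hrate hN'.le
          rwa [mul_div_cancel₀ _ hN'.ne'] at this
  · rw [Finset.not_nonempty_iff_eq_empty, Finset.filter_eq_empty_iff] at hne
    have : prob (prodW w (Fin N)) E = 0 :=
      Finset.sum_eq_zero fun x hx => if_neg (hne hx)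
    rw [this]
    exact (Real.exp_pos _).le

theorem prob_meanError (hw : IsDist w) {φ : Z → ℝ} (hφ : ∀ z, φ z = 0 ∨ φ z = 1) {N : ℕ}
    (hN : 0 < N) {L : ℝ} (hL : 0 < L) :
    prob (prodW w (Fin N)) (fun x => meanError N L ((∑ i, φ (x i)) / N) ≤
      |(∑ i, φ (x i)) / N - expect w φ|) ≤ 2 * Real.exp (-L) := by
  have h1 := prob_meanError_upper hw hφ hN hL
  have h2 := prob_meanError_upper hw (φ := fun z => 1 - φ z)
    (fun z => by rcases hφ z with h | h <;> simp [h]) hN hL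
  have hN' : (N : ℝ) ≠ 0 := by exact_mod_cast hN.ne'
  have e : ∀ x : Fin N → Z, (∑ i, (1 - φ (x i))) / (N : ℝ) = 1 - (∑ i, φ (x i)) / N := by
    intro x
    rw [Finset.sum_sub_distrib]
    simp
    field_simp
  simp only [e, expect_one_sub hw] at h2
  refine (prob_mono (hw.prodW (Fin N)) fun x _ hx => ?_).trans
    ((prob_or_le (hw.prodW (Fin N)) _ _).trans ((add_le_add h1 h2).trans (two_mul _).ge))
  rcases le_abs.1 hx with h | h
  · exact Or.inl h
  · right
    have : meanError N L (1 - (∑ i, φ (x i)) / N) = meanError N L ((∑ i, φ (x i)) / N) := by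
      rw [meanError, meanError]
      congr 5
      ring
    rw [this]
    linarith

theorem sum_sq_sub_range (z : ℕ → ℝ) (N : ℕ) :
    ∑ j₂ ∈ Finset.range N, ∑ j₁ ∈ Finset.range j₂, (z j₁ - z j₂) ^ 2 =
      N * ∑ j ∈ Finset.range N, z j ^ 2 - (∑ j ∈ Finset.range N, z j) ^ 2 := by
  induction N with
  | zero => simp
  | succ N ih =>
    rw [Finset.sum_range_succ, ih, Finset.sum_range_succ, Finset.sum_range_succ]
    have : ∀ j, (z j - z N) ^ 2 = z j ^ 2 - 2 * z N * z j + z N ^ 2 := fun j => by ring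
    simp only [this, Finset.sum_add_distrib, Finset.sum_sub_distrib, ← Finset.mul_sum,
      Finset.sum_const, Finset.card_range, nsmul_eq_mul]
    push_cast
    ring

theorem mean_mul_le_sampleVar {z : ℕ → ℝ} (hz : ∀ j, z j = 0 ∨ z j = 1) (N : ℕ) :
    (∑ j ∈ Finset.range N, z j) / N * (1 - (∑ j ∈ Finset.range N, z j) / N) ≤ sampleVar N z := by
  have hsq : ∀ j, z j ^ 2 = z j := fun j => by rcases hz j with h | h <;> simp [h]
  have h0 : 0 ≤ ∑ j ∈ Finset.range N, z j :=
    Finset.sum_nonneg fun j _ => by rcases hz j with h | h <;> simp [h]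
  have h1 : ∑ j ∈ Finset.range N, z j ≤ N := by
    calc _ ≤ ∑ _j ∈ Finset.range N, (1 : ℝ) :=
          Finset.sum_le_sum fun j _ => by rcases hz j with h | h <;> simp [h]
      _ = N := by simp
  rw [sampleVar, sum_sq_sub_range]
  simp only [hsq]
  rcases Nat.lt_or_ge N 2 with hN | hN
  · interval_cases N
    · simp
    · rcases hz 0 with h | h <;> simp [h]
  · have hN' : (2 : ℝ) ≤ N := by exact_mod_cast hN
    set S := ∑ j ∈ Finset.range N, z j
    have e : S / N * (1 - S / N) = 1 / ((N : ℝ) * N) * (N * S - S ^ 2) := by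
      field_simp
    rw [e]
    refine mul_le_mul_of_nonneg_right ?_ (by nlinarith)
    exact one_div_le_one_div_of_le (by nlinarith) (by nlinarith)

theorem meanError_le_bernsteinError {z : ℕ → ℝ} (hz : ∀ j, z j = 0 ∨ z j = 1) (N : ℕ) {δ₀ : ℝ}
    (hL : 0 ≤ Real.log (2 / δ₀)) :
    meanError N (Real.log (2 / δ₀)) ((∑ j ∈ Finset.range N, z j) / N) ≤
      bernsteinError N δ₀ (sampleVar N z) := by
  rw [meanError, bernsteinError]
  gcongr
  exact mean_mul_le_sampleVar hz N

end Chernoff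

/-! ### Rademacher sums -/

section Rademacher

/-- The sign of a fair coin. -/
def coinSign (b : Bool) : ℝ := if b then 1 else -1

/-- The fair coin. -/
def coin (_ : Bool) : ℝ := 1 / 2

theorem isDist_coin : IsDist coin where
  nonneg _ := by norm_num [coin]
  sum_eq_one := by norm_num [coin]

theorem rademacher_upper {N : ℕ} (a : Fin N → ℝ) {S T : ℝ} (hS : 0 < S) (hT : 0 ≤ T)
    (ha : ∑ i, a i ^ 2 ≤ S) :
    prob (prodW coin (Fin N)) (fun σ => T ≤ ∑ i, coinSign (σ i) * a i) ≤
      Real.exp (-(T ^ 2 / (2 * S))) := by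
  have h := prob_le_sum (isDist_coin.prodW (Fin N))
    (E := fun σ => T ≤ ∑ i, coinSign (σ i) * a i)
    (F := fun σ => Real.exp (-(T / S * T)) * ∏ i, Real.exp (T / S * (coinSign (σ i) * a i)))
    (fun σ => mul_nonneg (Real.exp_pos _).le (Finset.prod_nonneg fun _ _ => (Real.exp_pos _).le))
    (fun σ hσ => by
      rw [← Real.exp_sum, ← Real.exp_add, Real.one_le_exp_iff, ← Finset.mul_sum]
      have := mul_le_mul_of_nonneg_left hσ (div_nonneg hT hS.le)
      linarith)
  refine h.trans ?_
  have e : ∀ σ : Fin N → Bool, prodW coin (Fin N) σ *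
      (Real.exp (-(T / S * T)) * ∏ i, Real.exp (T / S * (coinSign (σ i) * a i))) =
        Real.exp (-(T / S * T)) * (prodW coin (Fin N) σ *
          ∏ i, Real.exp (T / S * (coinSign (σ i) * a i))) := fun σ => by ring
  simp only [e]
  rw [← Finset.mul_sum,
    sum_prodW_mul_prod coin (ι := Fin N) fun i b => Real.exp (T / S * (coinSign b * a i))]
  have h2 : ∀ i, ∑ b, coin b * Real.exp (T / S * (coinSign b * a i)) ≤
      Real.exp ((T / S) ^ 2 / 2 * a i ^ 2) := by
    intro i
    have : ∑ b, coin b * Real.exp (T / S * (coinSign b * a i)) = Real.cosh (T / S * a i) := by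
      rw [Real.cosh_eq, Fintype.sum_bool]
      simp only [coin, coinSign]
      simp
      ring
    rw [this]
    refine (Real.cosh_le_exp_half_sq _).trans (le_of_eq ?_)
    congr 1
    ring
  refine (mul_le_mul_of_nonneg_left (Finset.prod_le_prod (fun i _ => Finset.sum_nonneg fun b _ =>
    mul_nonneg (isDist_coin.nonneg b) (Real.exp_pos _).le) fun i _ => h2 i)
      (Real.exp_pos _).le).trans ?_
  rw [← Real.exp_sum, ← Real.exp_add, Real.exp_le_exp, ← Finset.mul_sum]
  have h3 := mul_le_mul_of_nonneg_left ha (by positivity : 0 ≤ (T / S) ^ 2 / 2)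
  have h4 : (T / S) ^ 2 / 2 * S = T ^ 2 / (2 * S) := by field_simp
  have h5 : T / S * T = 2 * (T ^ 2 / (2 * S)) := by field_simp
  linarith

theorem rademacher {N : ℕ} (a : Fin N → ℝ) {S T : ℝ} (hS : 0 < S) (hT : 0 ≤ T)
    (ha : ∑ i, a i ^ 2 ≤ S) :
    prob (prodW coin (Fin N)) (fun σ => T ≤ |∑ i, coinSign (σ i) * a i|) ≤
      2 * Real.exp (-(T ^ 2 / (2 * S))) := by
  have h1 := rademacher_upper a hS hT ha
  have h2 := rademacher_upper (fun i => -a i) hS hT (by simpa using ha)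
  refine (prob_mono (isDist_coin.prodW (Fin N)) fun σ _ hσ => ?_).trans
    ((prob_or_le (isDist_coin.prodW (Fin N)) _ _).trans ((add_le_add h1 h2).trans (two_mul _).ge))
  rcases le_abs.1 hσ with h | h
  · exact Or.inl h
  · right
    simpa using h

end Rademacher

/-! ### Set families of bounded VC dimension -/

section VC

variable {Y I : Type*}

/-- The trace of a set along a map. -/
def pull [Fintype I] (y : I → Y) (f : Finset Y) : Finset I := Finset.univ.filter fun i => y i ∈ f

theorem mem_pull [Fintype I] {y : I → Y} {f : Finset Y} {i : I} : i ∈ pull y f ↔ y i ∈ f := by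
  simp [pull]

theorem vcDim_image_pull_le [Fintype I] [DecidableEq I] [DecidableEq Y] (y : I → Y)
    (F : Finset (Finset Y)) : (F.image (pull y)).vcDim ≤ F.vcDim := by
  refine Finset.sup_le fun S hS => ?_
  rw [Finset.mem_shatterer] at hS
  have hex : ∀ t ⊆ S, ∃ f ∈ F, ∀ i ∈ S, y i ∈ f ↔ i ∈ t := by
    intro t ht
    obtain ⟨u, hu, he⟩ := hS ht
    obtain ⟨f, hf, rfl⟩ := Finset.mem_image.1 hu
    refine ⟨f, hf, fun i hi => ?_⟩
    rw [← he, Finset.mem_inter, mem_pull]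
    simp [hi]
  have hinj : Set.InjOn y S := by
    intro i hi j hj hij
    by_contra hne
    obtain ⟨f, -, hf⟩ := hex {i} (by simpa using hi)
    have h1 := (hf i hi).2 (by simp)
    rw [hij] at h1
    have h2 := (hf j hj).1 h1
    exact hne (Finset.mem_singleton.1 h2).symm
  rw [← Finset.card_image_of_injOn hinj]
  refine Finset.Shatters.card_le_vcDim fun u hu => ?_
  obtain ⟨f, hfF, hf⟩ := hex (S.filter fun i => y i ∈ u) (Finset.filter_subset _ _)
  refine ⟨f, hfF, ?_⟩
  ext z
  simp only [Finset.mem_inter, Finset.mem_image]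
  constructor
  · rintro ⟨⟨i, hi, rfl⟩, hz⟩
    exact (Finset.mem_filter.1 ((hf i hi).1 hz)).2
  · intro hz
    obtain ⟨i, hi, rfl⟩ := Finset.mem_image.1 (hu hz)
    exact ⟨⟨i, hi, rfl⟩, (hf i hi).2 (Finset.mem_filter.2 ⟨hi, hz⟩)⟩

theorem sum_choose_le {d n : ℕ} (hd : 1 ≤ d) (hdn : d ≤ n) :
    (∑ i ∈ Finset.Iic d, (n.choose i : ℝ)) ≤ (Real.exp 1 * n / d) ^ d := by
  have hd' : (0 : ℝ) < d := by exact_mod_cast hd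
  have hn' : (0 : ℝ) < n := by exact_mod_cast (by omega : 0 < n)
  have hx0 : 0 < (d : ℝ) / n := by positivity
  have hx1 : (d : ℝ) / n ≤ 1 := by rw [div_le_one hn']; exact_mod_cast hdn
  have h1 : (∑ i ∈ Finset.Iic d, (n.choose i : ℝ)) * ((d : ℝ) / n) ^ d ≤ Real.exp 1 ^ d := by
    calc _ = ∑ i ∈ Finset.Iic d, (n.choose i : ℝ) * ((d : ℝ) / n) ^ d := Finset.sum_mul _ _ _
      _ ≤ ∑ i ∈ Finset.Iic d, (n.choose i : ℝ) * ((d : ℝ) / n) ^ i :=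
          Finset.sum_le_sum fun i hi => mul_le_mul_of_nonneg_left
            (pow_le_pow_of_le_one hx0.le hx1 (Finset.mem_Iic.1 hi)) (by positivity)
      _ ≤ ∑ i ∈ Finset.range (n + 1), (n.choose i : ℝ) * ((d : ℝ) / n) ^ i :=
          Finset.sum_le_sum_of_subset_of_nonneg (fun i hi => by
            have := Finset.mem_Iic.1 hi
            exact Finset.mem_range.2 (by omega)) fun _ _ _ => by positivity
      _ = ((d : ℝ) / n + 1) ^ n := by
          rw [add_pow]
          exact Finset.sum_congr rfl fun i _ => by rw [one_pow]; ring
      _ ≤ Real.exp ((d : ℝ) / n) ^ n :=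
          pow_le_pow_left₀ (by positivity) (Real.add_one_le_exp _) n
      _ = Real.exp 1 ^ d := by
          rw [← Real.exp_nat_mul, ← Real.exp_nat_mul]
          congr 1
          field_simp
  rw [← le_div_iff₀ (by positivity), ← div_pow] at h1
  refine h1.trans (le_of_eq ?_)
  congr 1
  field_simp

variable [Fintype Y] [DecidableEq Y]

/-- Members of a separated family are told apart by a random sample. -/
theorem card_le_of_separated {F : Finset (Finset Y)} {d : ℕ} (hd : 1 ≤ d) (hF : F.vcDim ≤ d)
    (hY : 0 < Fintype.card Y) {α : ℝ}
    (hsep : ∀ f ∈ F, ∀ h ∈ F, f ≠ h → α * Fintype.card Y ≤ (symmDiff f h).card) {k : ℕ}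
    (hk : d ≤ k) (hM : (F.card : ℝ) ^ 2 * Real.exp (-(α * k)) < 1) :
    (F.card : ℝ) ≤ (Real.exp 1 * k / d) ^ d := by
  have hY' : (0 : ℝ) < Fintype.card Y := by exact_mod_cast hY
  set u : Y → ℝ := fun _ => 1 / Fintype.card Y with hu
  have hud : IsDist u := ⟨fun _ => by positivity, by simp [hu]; field_simp⟩
  have hpair : ∀ P ∈ F.offDiag, prob (prodW u (Fin k)) (fun y => ∀ i, y i ∈ P.1 ↔ y i ∈ P.2) ≤
      Real.exp (-(α * k)) := by
    intro P hP
    obtain ⟨h1, h2, hne⟩ := Finset.mem_offDiag.1 hP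
    have hle := prob_le_sum (hud.prodW (Fin k)) (E := fun y => ∀ i, y i ∈ P.1 ↔ y i ∈ P.2)
      (F := fun y => ∏ i, if y i ∈ symmDiff P.1 P.2 then (0 : ℝ) else 1)
      (fun y => Finset.prod_nonneg fun i _ => by split_ifs <;> norm_num)
      (fun y hy => by
        refine le_of_eq (Finset.prod_eq_one fun i _ => ?_).symm
        rw [if_neg]
        have := hy i
        rw [Finset.mem_symmDiff]
        tauto)
    refine hle.trans ?_
    rw [sum_prodW_mul_prod u (ι := Fin k) fun _ z =>
      if z ∈ symmDiff P.1 P.2 then (0 : ℝ) else 1]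
    have hs : ∑ z, u z * (if z ∈ symmDiff P.1 P.2 then (0 : ℝ) else 1) =
        1 - (symmDiff P.1 P.2).card / Fintype.card Y := by
      have : ((symmDiff P.1 P.2).card : ℝ) / Fintype.card Y =
          ∑ z, u z * if z ∈ symmDiff P.1 P.2 then (1 : ℝ) else 0 := by
        simp only [mul_ite, mul_one, mul_zero]
        rw [Finset.sum_ite_mem, Finset.univ_inter, Finset.sum_const, nsmul_eq_mul]
        ring
      rw [this, eq_sub_iff_add_eq, ← Finset.sum_add_distrib]
      exact (Finset.sum_congr rfl fun z _ => by split_ifs <;> ring).trans hud.sum_eq_one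
    rw [Finset.prod_const, hs, Finset.card_univ, Fintype.card_fin]
    have hα : α ≤ (symmDiff P.1 P.2).card / (Fintype.card Y : ℝ) :=
      (le_div_iff₀ hY').2 (hsep _ h1 _ h2 hne)
    have h0 : 0 ≤ 1 - ((symmDiff P.1 P.2).card : ℝ) / Fintype.card Y := by
      rw [sub_nonneg, div_le_one hY']
      exact_mod_cast Finset.card_le_univ _
    calc _ ≤ Real.exp (-α) ^ k := pow_le_pow_left₀ h0 (by
            have := Real.add_one_le_exp (-α)
            linarith) k
      _ = _ := by rw [← Real.exp_nat_mul]; congr 1; ring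
  have hlt : prob (prodW u (Fin k)) (fun y => ∃ P ∈ F.offDiag, ∀ i, y i ∈ P.1 ↔ y i ∈ P.2) < 1 := by
    refine lt_of_le_of_lt ((prob_exists_le (hud.prodW (Fin k)) _ _).trans
      (Finset.sum_le_sum hpair)) (lt_of_le_of_lt ?_ hM)
    rw [Finset.sum_const, nsmul_eq_mul]
    refine mul_le_mul_of_nonneg_right ?_ (Real.exp_pos _).le
    rw [Finset.offDiag_card]
    have : F.card * F.card - F.card ≤ F.card ^ 2 := by rw [sq]; omega
    exact_mod_cast this
  have hexy : ∃ y : Fin k → Y, ¬ ∃ P ∈ F.offDiag, ∀ i, y i ∈ P.1 ↔ y i ∈ P.2 := by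
    by_contra hcon
    push Not at hcon
    refine hlt.ne ?_
    rw [← (hud.prodW (Fin k)).sum_eq_one]
    exact Finset.sum_congr rfl fun y _ => if_pos (hcon y)
  obtain ⟨y, hy⟩ := hexy
  have hinj : Set.InjOn (pull y) F := by
    intro f hf h hh hfh
    by_contra hne
    refine hy ⟨(f, h), Finset.mem_offDiag.2 ⟨hf, hh, hne⟩, fun i => ?_⟩
    rw [← mem_pull, ← mem_pull, hfh]
  have hT := vcDim_image_pull_le y F
  have hcard : F.card ≤ ∑ i ∈ Finset.Iic d, k.choose i := by
    rw [← Finset.card_image_of_injOn hinj]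
    refine (Finset.card_le_card_shatterer _).trans (Finset.card_shatterer_le_sum_vcDim.trans ?_)
    rw [Fintype.card_fin]
    exact Finset.sum_le_sum_of_subset (Finset.Iic_subset_Iic.2 (hT.trans hF))
  calc (F.card : ℝ) ≤ ∑ i ∈ Finset.Iic d, (k.choose i : ℝ) := by exact_mod_cast hcard
    _ ≤ _ := sum_choose_le hd hk

/-- The packing numbers of a family of VC dimension `d` at scale `4 ^ (-j)`. -/
theorem packing_le {F : Finset (Finset Y)} {d : ℕ} (hd : 1 ≤ d) (hF : F.vcDim ≤ d)
    (hY : 0 < Fintype.card Y) (j : ℕ)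
    (hsep : ∀ f ∈ F, ∀ h ∈ F, f ≠ h → (1 / 4 : ℝ) ^ j * Fintype.card Y ≤ (symmDiff f h).card) :
    (F.card : ℝ) ≤ Real.exp (6 * d * (j + 1)) := by
  by_contra! hlt
  set B := Real.exp (6 * d * (j + 1)) with hB
  have hd' : (1 : ℝ) ≤ d := by exact_mod_cast hd
  have hj' : (0 : ℝ) ≤ j := Nat.cast_nonneg j
  have hB1 : 1 ≤ B := Real.one_le_exp (by positivity)
  have hfl : ⌊B⌋₊ + 1 ≤ F.card := (Nat.floor_lt (by positivity)).2 hlt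
  obtain ⟨F', hF'F, hF'c⟩ := Finset.exists_subset_card_eq hfl
  have hM1 : B < F'.card := by rw [hF'c]; push_cast; exact Nat.lt_floor_add_one B
  have hM2 : (F'.card : ℝ) ≤ 2 * B := by
    rw [hF'c]
    push_cast
    have := Nat.floor_le (by positivity : 0 ≤ B)
    linarith
  set K : ℝ := 4 ^ j * (12 * d * (j + 1) + 2) with hK
  have h4 : (1 : ℝ) ≤ 4 ^ j := one_le_pow₀ (by norm_num)
  have hdj : (d : ℝ) ≤ d * (j + 1) := le_mul_of_one_le_right (by positivity) (by linarith)
  have hKd : (d : ℝ) ≤ K := by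
    have : (12 * d * (j + 1) + 2 : ℝ) ≤ K := le_mul_of_one_le_left (by positivity) h4
    nlinarith
  have hk1 : K ≤ ⌈K⌉₊ := Nat.le_ceil K
  have hk2 : (⌈K⌉₊ : ℝ) < K + 1 := Nat.ceil_lt_add_one (by positivity)
  have hdk : d ≤ ⌈K⌉₊ := by exact_mod_cast hKd.trans hk1
  have hexp1 : (2.7 : ℝ) < Real.exp 1 := by linarith [Real.exp_one_gt_d9]
  have he2 : (4 : ℝ) < Real.exp 2 := by
    have : Real.exp 2 = Real.exp 1 ^ 2 := by rw [← Real.exp_nat_mul]; norm_num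
    rw [this]
    nlinarith
  have he3 : (15 : ℝ) < Real.exp 3 := by
    have : Real.exp 3 = Real.exp 1 ^ 3 := by rw [← Real.exp_nat_mul]; norm_num
    rw [this]
    have := pow_lt_pow_left₀ hexp1 (by norm_num) (three_ne_zero)
    norm_num at this ⊢
    linarith
  have hsmall : (F'.card : ℝ) ^ 2 * Real.exp (-((1 / 4 : ℝ) ^ j * ⌈K⌉₊)) < 1 := by
    have h1 : (12 * d * (j + 1) + 2 : ℝ) ≤ (1 / 4 : ℝ) ^ j * ⌈K⌉₊ := by
      have := mul_le_mul_of_nonneg_left hk1 (by positivity : (0 : ℝ) ≤ (1 / 4) ^ j)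
      rwa [hK, ← mul_assoc, ← mul_pow, one_div_mul_cancel (by norm_num), one_pow, one_mul] at this
    have h2 : Real.exp (-((1 / 4 : ℝ) ^ j * ⌈K⌉₊)) ≤ (B ^ 2 * Real.exp 2)⁻¹ := by
      rw [← Real.exp_nat_mul, ← Real.exp_add, ← Real.exp_neg, Real.exp_le_exp]
      push_cast
      linarith
    have h3 : (F'.card : ℝ) ^ 2 ≤ 4 * B ^ 2 := by nlinarith
    calc _ ≤ 4 * B ^ 2 * (B ^ 2 * Real.exp 2)⁻¹ := by gcongr
      _ = 4 / Real.exp 2 := by field_simp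
      _ < 1 := (div_lt_one (Real.exp_pos _)).2 he2
  have hfin := card_le_of_separated hd ((Finset.vcDim_mono hF'F).trans hF) hY
    (fun f hf h hh => hsep f (hF'F hf) h (hF'F hh)) hdk hsmall
  have hbase : Real.exp 1 * ⌈K⌉₊ / d ≤ Real.exp (3 * j + 4) := by
    have hK' : (⌈K⌉₊ : ℝ) ≤ 4 ^ j * (15 * (j + 1)) * d := by
      have : K + 1 ≤ 4 ^ j * (12 * d * (j + 1) + 3) := by rw [hK]; nlinarith
      have h5 : (12 * d * (j + 1) + 3 : ℝ) ≤ 15 * (j + 1) * d := by nlinarith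
      have := mul_le_mul_of_nonneg_left h5 (by positivity : (0 : ℝ) ≤ 4 ^ j)
      linarith
    have h4e : (4 : ℝ) ^ j ≤ Real.exp (2 * j) := by
      rw [mul_comm, Real.exp_nat_mul]
      exact pow_le_pow_left₀ (by norm_num) he2.le j
    have hje : (j + 1 : ℝ) ≤ Real.exp j := Real.add_one_le_exp _
    rw [div_le_iff₀ (by positivity)]
    calc Real.exp 1 * ⌈K⌉₊ ≤ Real.exp 1 * (4 ^ j * (15 * (j + 1)) * d) := by gcongr
      _ ≤ Real.exp 1 * (Real.exp (2 * j) * (Real.exp 3 * Real.exp j) * d) := by gcongr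
      _ = Real.exp (3 * j + 4) * d := by
          rw [← Real.exp_add, ← Real.exp_add, ← mul_assoc, ← Real.exp_add]
          ring_nf
  have : (F'.card : ℝ) ≤ B := by
    refine hfin.trans ((pow_le_pow_left₀ (by positivity) hbase d).trans ?_)
    rw [← Real.exp_nat_mul, hB, Real.exp_le_exp]
    nlinarith
  linarith

theorem exists_net (F : Finset (Finset Y)) (ρ : ℝ) :
    ∃ F' ⊆ F, (∀ f ∈ F', ∀ h ∈ F', f ≠ h → ρ ≤ (symmDiff f h).card) ∧
      ∀ f ∈ F, ∃ h ∈ F', f = h ∨ ((symmDiff f h).card : ℝ) < ρ := by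
  obtain ⟨F', -, hm⟩ := Finite.exists_le_maximal (a := (∅ : Finset (Finset Y)))
    (p := fun F' => F' ⊆ F ∧ ∀ f ∈ F', ∀ h ∈ F', f ≠ h → ρ ≤ (symmDiff f h).card) (by simp)
  refine ⟨F', hm.1.1, hm.1.2, fun f hf => ?_⟩
  by_contra! hcon
  have hins : insert f F' ⊆ F' := hm.2 ⟨Finset.insert_subset hf hm.1.1, ?_⟩
    (Finset.subset_insert _ _)
  · exact (hcon f (hins (Finset.mem_insert_self _ _))).1 rfl
  · intro a ha b hb hab
    rcases Finset.mem_insert.1 ha with rfl | ha' <;>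
      rcases Finset.mem_insert.1 hb with rfl | hb'
    · exact absurd rfl hab
    · exact (hcon b hb').2
    · rw [symmDiff_comm]; exact (hcon a ha').2
    · exact hm.1.2 a ha' b hb' hab

/-- Approximations of the members of a family of bounded VC dimension at all scales. -/
theorem exists_chain {F : Finset (Finset Y)} {d : ℕ} (hd : 1 ≤ d) (hF : F.vcDim ≤ d)
    (hY : 0 < Fintype.card Y) : ∃ π : ℕ → Finset Y → Finset Y,
      (∀ j, ((F.image (π j)).card : ℝ) ≤ Real.exp (6 * d * (j + 1))) ∧
      (∀ j, ∀ f ∈ F, ((symmDiff f (π j f)).card : ℝ) ≤ (1 / 4 : ℝ) ^ j * Fintype.card Y) ∧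
      (∀ f, π 0 f = ∅) ∧ ∃ J, 1 ≤ J ∧ ∀ f ∈ F, π J f = f := by
  choose net hsub hsep hcov using fun j : ℕ => exists_net F ((1 / 4 : ℝ) ^ j * Fintype.card Y)
  choose! near hnear hdist using hcov
  have hY' : (0 : ℝ) < Fintype.card Y := by exact_mod_cast hY
  refine ⟨fun j f => if j = 0 then ∅ else near j f, fun j => ?_, fun j f hf => ?_,
    fun f => if_pos rfl, ?_⟩
  · rcases Nat.eq_zero_or_pos j with rfl | hj
    · have h1 : (F.image fun f => if (0 : ℕ) = 0 then (∅ : Finset Y) else near 0 f).card ≤ 1 := by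
        refine Finset.card_le_one.2 fun a ha b hb => ?_
        simp only [if_true, Finset.mem_image] at ha hb
        obtain ⟨-, -, rfl⟩ := ha
        obtain ⟨-, -, rfl⟩ := hb
        rfl
      have h2 : (1 : ℝ) ≤ Real.exp (6 * d * ((0 : ℕ) + 1)) := Real.one_le_exp (by positivity)
      exact le_trans (by exact_mod_cast h1) h2
    · refine le_trans ?_ (packing_le hd ((Finset.vcDim_mono (hsub j)).trans hF) hY j (hsep j))
      refine Nat.cast_le.2 (Finset.card_le_card fun h hh => ?_)
      obtain ⟨f, hf, rfl⟩ := Finset.mem_image.1 hh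
      dsimp only
      rw [if_neg hj.ne']
      exact hnear j f hf
  · rcases Nat.eq_zero_or_pos j with rfl | hj
    · rw [pow_zero, one_mul]
      exact_mod_cast Finset.card_le_univ _
    · dsimp only
      rw [if_neg hj.ne']
      rcases hdist j f hf with h | h
      · rw [← h]; simp
      · exact h.le
  · obtain ⟨J, hJ⟩ := exists_pow_lt_of_lt_one (one_div_pos.2 hY')
      (by norm_num : (1 / 4 : ℝ) < 1)
    refine ⟨J + 1, by omega, fun f hf => ?_⟩
    dsimp only
    rw [if_neg (by omega)]
    rcases hdist (J + 1) f hf with h | h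
    · exact h.symm
    · have h1 : (1 / 4 : ℝ) ^ (J + 1) * Fintype.card Y < 1 := by
        rw [lt_div_iff₀ hY'] at hJ
        rw [pow_succ]
        have : (0 : ℝ) ≤ (1 / 4) ^ J * Fintype.card Y := by positivity
        nlinarith
      have h2 : (symmDiff f (near (J + 1) f)).card < 1 := by exact_mod_cast h.trans h1
      have h3 := Finset.card_eq_zero.1 (Nat.lt_one_iff.1 h2)
      exact (symmDiff_eq_bot.1 h3).symm

end VC

/-! ### Chaining -/

section Chaining

/-- The indicator function of a finite set. -/
def ind {Z : Type*} (f : Finset Z) (z : Z) : ℝ := if z ∈ f then 1 else 0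

theorem ind_eq {Z : Type*} (f : Finset Z) (z : Z) : ind f z = 0 ∨ ind f z = 1 := by
  unfold ind
  split_ifs <;> simp

theorem sq_ind_sub_ind {Z : Type*} [DecidableEq Z] (f h : Finset Z) (z : Z) :
    (ind f z - ind h z) ^ 2 = ind (symmDiff f h) z := by
  unfold ind
  by_cases h1 : z ∈ f <;> by_cases h2 : z ∈ h <;> simp [Finset.mem_symmDiff, h1, h2]

variable {N : ℕ}

/-- The difference of the indicators at the two members of the `i`-th pair. -/
def pairDiff (f : Finset (Fin N × Bool)) (i : Fin N) : ℝ := ind f (i, true) - ind f (i, false)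

theorem sum_sq_pairDiff_sub_le (f h : Finset (Fin N × Bool)) :
    ∑ i, (pairDiff f i - pairDiff h i) ^ 2 ≤ 2 * (symmDiff f h).card := by
  have hcard : ((symmDiff f h).card : ℝ) =
      ∑ i, (ind (symmDiff f h) (i, true) + ind (symmDiff f h) (i, false)) := by
    have : ((symmDiff f h).card : ℝ) = ∑ z, ind (symmDiff f h) z := by
      simp [ind]
    rw [this, Fintype.sum_prod_type]
    simp
  rw [hcard, Finset.mul_sum]
  refine Finset.sum_le_sum fun i _ => ?_
  rw [← sq_ind_sub_ind, ← sq_ind_sub_ind, pairDiff, pairDiff]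
  nlinarith [sq_nonneg ((ind f (i, true) - ind h (i, true)) +
    (ind f (i, false) - ind h (i, false)))]

theorem sum_succ_mul_half_pow (J : ℕ) :
    ∑ j ∈ Finset.range J, ((j : ℝ) + 1) * (1 / 2) ^ j = 4 - (J + 2) * 2 * (1 / 2) ^ J := by
  induction J with
  | zero => norm_num
  | succ J ih =>
    rw [Finset.sum_range_succ, ih, pow_succ]
    push_cast
    ring

theorem sum_half_pow_le (J : ℕ) : ∑ j ∈ Finset.range J, (1 / 2 : ℝ) ^ j ≤ 2 := by
  have : ∑ j ∈ Finset.range J, (1 / 2 : ℝ) ^ j = 2 - 2 * (1 / 2) ^ J := by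
    induction J with
    | zero => norm_num
    | succ J ih => rw [Finset.sum_range_succ, ih, pow_succ]; ring
  rw [this]
  have : (0 : ℝ) ≤ (1 / 2) ^ J := by positivity
  linarith

theorem exp_neg_level_le (j : ℕ) : Real.exp (-(6 * ((j : ℝ) + 1))) ≤ 1 / 32 * (1 / 2) ^ j := by
  have h1 : (2 : ℝ) ≤ Real.exp 1 := by linarith [Real.exp_one_gt_d9]
  have h2 : Real.exp (6 * ((j : ℝ) + 1)) = Real.exp 1 ^ 6 * (Real.exp 1 ^ 6) ^ j := by
    rw [← pow_mul, ← pow_add, ← Real.exp_nat_mul]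
    congr 1
    push_cast
    ring
  have h3 : (32 : ℝ) ≤ Real.exp 1 ^ 6 := by
    have := pow_le_pow_left₀ (by norm_num) h1 6
    norm_num at this ⊢
    linarith
  have h4 : (2 : ℝ) ^ j ≤ (Real.exp 1 ^ 6) ^ j := pow_le_pow_left₀ (by norm_num) (by linarith) j
  rw [Real.exp_neg, h2, one_div, one_div, inv_pow, ← mul_inv]
  exact inv_anti₀ (by positivity) (mul_le_mul h3 h4 (by positivity) (by positivity))

/-- One link of the chain. -/
theorem prob_link_le (hN : 0 < N) {ε : ℝ} (hε : 0 < ε) {f h : Finset (Fin N × Bool)} {j : ℕ}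
    (hfh : ((symmDiff f h).card : ℝ) ≤ 4 * (1 / 4) ^ j * N) :
    prob (prodW coin (Fin N)) (fun σ => N * (ε / 8) * ((j + 1) * (1 / 2) ^ j) ≤
      |∑ i, coinSign (σ i) * (pairDiff f i - pairDiff h i)|) ≤
        2 * Real.exp (-(N * ε ^ 2 * (j + 1) ^ 2 / 1024)) := by
  have hN' : (0 : ℝ) < N := by exact_mod_cast hN
  refine (rademacher (S := 8 * (1 / 4) ^ j * N) (fun i => pairDiff f i - pairDiff h i)
    (by positivity) (by positivity) ?_).trans (le_of_eq ?_)
  · have := sum_sq_pairDiff_sub_le f h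
    linarith
  · congr 3
    have : ((1 / 4 : ℝ)) ^ j = ((1 / 2) ^ j) ^ 2 := by rw [← pow_mul, mul_comm, pow_mul]; norm_num
    rw [this]
    field_simp
    norm_num

/-- All links of one level. -/
theorem prob_level_le (hN : 0 < N) {ε l : ℝ} (hε : 0 < ε) (hl : 0 ≤ l) {d : ℕ} (hd : 1 ≤ d)
    (hNε : 24576 * (d + l) ≤ N * ε ^ 2) {j : ℕ}
    (links : Finset (Finset (Fin N × Bool) × Finset (Fin N × Bool)))
    (hcard : (links.card : ℝ) ≤ Real.exp (18 * d * (j + 1)))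
    (hdist : ∀ P ∈ links, ((symmDiff P.1 P.2).card : ℝ) ≤ 4 * (1 / 4) ^ j * N) :
    prob (prodW coin (Fin N)) (fun σ => ∃ P ∈ links, N * (ε / 8) * ((j + 1) * (1 / 2) ^ j) ≤
        |∑ i, coinSign (σ i) * (pairDiff P.1 i - pairDiff P.2 i)|) ≤
      Real.exp (-l) / 16 * (1 / 2) ^ j := by
  have hN' : (0 : ℝ) < N := by exact_mod_cast hN
  have hd' : (1 : ℝ) ≤ d := by exact_mod_cast hd
  have hj : (0 : ℝ) ≤ j := Nat.cast_nonneg j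
  refine (prob_exists_le (isDist_coin.prodW (Fin N)) _ _).trans ?_
  refine (Finset.sum_le_sum fun P hP => prob_link_le hN hε (hdist P hP)).trans ?_
  rw [Finset.sum_const, nsmul_eq_mul]
  have hexp : 24 * (d + l) * (j + 1) ≤ N * ε ^ 2 * (j + 1) ^ 2 / 1024 := by
    have h1 : 24 * (d + l) ≤ N * ε ^ 2 / 1024 := by linarith
    have h2 : ((j : ℝ) + 1) ≤ (j + 1) ^ 2 := by nlinarith
    calc 24 * (d + l) * (j + 1) ≤ N * ε ^ 2 / 1024 * (j + 1) ^ 2 :=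
          mul_le_mul h1 h2 (by positivity) (by positivity)
      _ = _ := by ring
  calc (links.card : ℝ) * (2 * Real.exp (-(N * ε ^ 2 * (j + 1) ^ 2 / 1024)))
      ≤ Real.exp (18 * d * (j + 1)) * (2 * Real.exp (-(24 * (d + l) * (j + 1)))) := by
        refine mul_le_mul hcard ?_ (by positivity) (by positivity)
        gcongr
    _ = 2 * Real.exp (18 * d * (j + 1) - 24 * (d + l) * (j + 1)) := by
        rw [sub_eq_add_neg, Real.exp_add]; ring
    _ ≤ 2 * (Real.exp (-l) * Real.exp (-(6 * ((j : ℝ) + 1)))) := by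
        rw [← Real.exp_add]
        gcongr
        nlinarith [mul_nonneg hl hj, mul_nonneg (sub_nonneg.2 hd') hj]
    _ ≤ 2 * (Real.exp (-l) * (1 / 32 * (1 / 2) ^ j)) := by
        gcongr
        exact exp_neg_level_le j
    _ = _ := by ring

/-- A large sum has a large link. -/
theorem exists_link_of_le {ε : ℝ} (hε : 0 < ε) (σ : Fin N → Bool)
    {ψ : ℕ → Finset (Fin N × Bool)} (hzero : ψ 0 = ∅) {J : ℕ} (hJ : 1 ≤ J)
    (h : N * (ε / 2) ≤ |∑ i, coinSign (σ i) * pairDiff (ψ J) i|) :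
    ∃ j ∈ Finset.range J, N * (ε / 8) * ((j + 1) * (1 / 2) ^ j) ≤
      |∑ i, coinSign (σ i) * (pairDiff (ψ (j + 1)) i - pairDiff (ψ j) i)| := by
  by_contra! hlink
  have htel : ∑ i, coinSign (σ i) * pairDiff (ψ J) i = ∑ j ∈ Finset.range J,
      ∑ i, coinSign (σ i) * (pairDiff (ψ (j + 1)) i - pairDiff (ψ j) i) := by
    simp only [mul_sub, Finset.sum_sub_distrib]
    rw [← Finset.sum_sub_distrib, Finset.sum_range_sub (fun j => ∑ i, coinSign (σ i) * pairDiff (ψ j) i), hzero]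
    simp [pairDiff, ind]
  have hlt := Finset.sum_lt_sum_of_nonempty
    (Finset.nonempty_range_iff.2 (by omega : J ≠ 0)) hlink
  rw [← Finset.mul_sum, sum_succ_mul_half_pow] at hlt
  have habs := Finset.abs_sum_le_sum_abs (fun j =>
    ∑ i, coinSign (σ i) * (pairDiff (ψ (j + 1)) i - pairDiff (ψ j) i)) (Finset.range J)
  rw [← htel] at habs
  have hpos : (0 : ℝ) ≤ N * (ε / 8) * ((J + 2) * 2 * (1 / 2) ^ J) := by positivity
  have : N * (ε / 8) * (4 - (J + 2) * 2 * (1 / 2) ^ J) =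
    N * (ε / 2) - N * (ε / 8) * ((J + 2) * 2 * (1 / 2) ^ J) := by ring
  linarith

theorem chaining {T : Finset (Finset (Fin N × Bool))} {d : ℕ} (hd : 1 ≤ d) (hT : T.vcDim ≤ d)
    (hN : 0 < N) {ε l : ℝ} (hε : 0 < ε) (hl : 0 ≤ l) (hNε : 24576 * (d + l) ≤ N * ε ^ 2) :
    prob (prodW coin (Fin N)) (fun σ => ∃ f ∈ T, N * (ε / 2) ≤
      |∑ i, coinSign (σ i) * pairDiff f i|) ≤ Real.exp (-l) / 8 := by
  have hcardY : (Fintype.card (Fin N × Bool) : ℝ) = 2 * N := by simp [mul_comm]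
  have hYpos : 0 < Fintype.card (Fin N × Bool) := by simp [hN]
  obtain ⟨π, hcard, hdist, hzero, J, hJ, hlast⟩ := exists_chain hd hT hYpos
  rw [hcardY] at hdist
  have hlc : ∀ j, ((T.image fun f => (π (j + 1) f, π j f)).card : ℝ) ≤
      Real.exp (18 * d * (j + 1)) := by
    intro j
    have h1 : (T.image fun f => (π (j + 1) f, π j f)).card ≤
        (T.image (π (j + 1))).card * (T.image (π j)).card := by
      rw [← Finset.card_product]
      refine Finset.card_le_card fun P hP => ?_
      obtain ⟨f, hf, rfl⟩ := Finset.mem_image.1 hP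
      exact Finset.mem_product.2 ⟨Finset.mem_image_of_mem _ hf, Finset.mem_image_of_mem _ hf⟩
    calc ((T.image fun f => (π (j + 1) f, π j f)).card : ℝ)
        ≤ (T.image (π (j + 1))).card * (T.image (π j)).card := by exact_mod_cast h1
      _ ≤ Real.exp (6 * d * ((j + 1 : ℕ) + 1)) * Real.exp (6 * d * (j + 1)) :=
          mul_le_mul (hcard _) (hcard _) (by positivity) (Real.exp_pos _).le
      _ ≤ _ := by
          rw [← Real.exp_add, Real.exp_le_exp]
          push_cast
          have : (0 : ℝ) ≤ d * j := by positivity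
          nlinarith
  have hld : ∀ j, ∀ P ∈ T.image fun f => (π (j + 1) f, π j f),
      ((symmDiff P.1 P.2).card : ℝ) ≤ 4 * (1 / 4) ^ j * N := by
    intro j P hP
    obtain ⟨f, hf, rfl⟩ := Finset.mem_image.1 hP
    have h1 := hdist (j + 1) f hf
    have h2 := hdist j f hf
    have h3 : (symmDiff (π (j + 1) f) (π j f)).card ≤
        (symmDiff f (π (j + 1) f)).card + (symmDiff f (π j f)).card := by
      refine le_trans (Finset.card_le_card ?_) (Finset.card_union_le _ _)
      rw [symmDiff_comm f (π (j + 1) f)]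
      exact symmDiff_triangle _ _ _
    have h3' : ((symmDiff (π (j + 1) f) (π j f)).card : ℝ) ≤
        (symmDiff f (π (j + 1) f)).card + (symmDiff f (π j f)).card := by exact_mod_cast h3
    rw [pow_succ] at h1
    have : (0 : ℝ) ≤ (1 / 4) ^ j * N := by positivity
    dsimp only
    linarith
  refine le_trans (prob_mono (isDist_coin.prodW (Fin N)) (F := fun σ => ∃ j ∈ Finset.range J,
    ∃ P ∈ T.image fun f => (π (j + 1) f, π j f), N * (ε / 8) * ((j + 1) * (1 / 2) ^ j) ≤
      |∑ i, coinSign (σ i) * (pairDiff P.1 i - pairDiff P.2 i)|) ?_) ?_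
  · rintro σ - ⟨f, hf, hbad⟩
    obtain ⟨j, hj, h⟩ := exists_link_of_le hε σ (ψ := fun j => π j f) (hzero f) hJ
      (by simpa only [hlast f hf] using hbad)
    exact ⟨j, hj, _, Finset.mem_image_of_mem _ hf, h⟩
  · refine (prob_exists_le (isDist_coin.prodW (Fin N)) _ _).trans ((Finset.sum_le_sum fun j _ =>
      prob_level_le hN hε hl hd hNε _ (hlc j) (hld j)).trans ?_)
    rw [← Finset.mul_sum]
    have := mul_le_mul_of_nonneg_left (sum_half_pow_le J)
      (by positivity : 0 ≤ Real.exp (-l) / 16)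
    linarith

end Chaining

/-! ### Uniform convergence -/

section Uniform

variable {Z : Type*} {w : Z → ℝ} {N : ℕ}

/-- Exchange the members of the pairs selected by `σ`. -/
def swapPairs (σ : Fin N → Bool) (P : (Fin N → Z) × (Fin N → Z)) : (Fin N → Z) × (Fin N → Z) :=
  (fun i => if σ i then P.1 i else P.2 i, fun i => if σ i then P.2 i else P.1 i)

theorem swapPairs_involutive (σ : Fin N → Bool) :
    Function.Involutive (swapPairs (Z := Z) σ) := by
  intro P
  refine Prod.ext (funext fun i => ?_) (funext fun i => ?_) <;>
    · simp only [swapPairs]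
      split_ifs <;> rfl

theorem prodW_swapPairs (w : Z → ℝ) (σ : Fin N → Bool) (P : (Fin N → Z) × (Fin N → Z)) :
    prodW w (Fin N) (swapPairs σ P).1 * prodW w (Fin N) (swapPairs σ P).2 =
      prodW w (Fin N) P.1 * prodW w (Fin N) P.2 := by
  simp only [prodW, swapPairs, ← Finset.prod_mul_distrib]
  refine Finset.prod_congr rfl fun i _ => ?_
  split_ifs
  · rfl
  · ring

variable [Fintype Z]

theorem prob_mean_upper_le (hw : IsDist w) {φ : Z → ℝ} (hφ : ∀ z, φ z = 0 ∨ φ z = 1) (hN : 0 < N)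
    {ε : ℝ} (hε : 0 < ε) (hNε : 20 ≤ N * ε ^ 2) :
    prob (prodW w (Fin N)) (fun x => ε / 2 ≤ (∑ i, φ (x i)) / N - expect w φ) ≤ 1 / 4 := by
  have hN' : (0 : ℝ) < N := by exact_mod_cast hN
  have hp := expect_nonneg hw hφ
  by_cases hq : expect w φ + ε / 2 ≤ 1
  · have h := chernoff hw hφ (by linarith : expect w φ < expect w φ + ε / 2) hq N
    refine le_trans (prob_mono (hw.prodW (Fin N)) fun x _ hx => ?_) (h.trans ?_)
    · have : expect w φ + ε / 2 ≤ (∑ i, φ (x i)) / N := by linarith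
      rw [le_div_iff₀ hN'] at this
      linarith
    · rw [add_sub_cancel_left]
      set q := expect w φ + ε / 2 with hqdef
      have hq0 : 0 < q := by linarith
      have hden : 2 * (q * (1 - q) + ε / 2) ≤ 5 / 2 := by nlinarith [sq_nonneg (q - 1 / 2)]
      have hden0 : 0 < 2 * (q * (1 - q) + ε / 2) := by
        have := mul_nonneg hq0.le (sub_nonneg.2 hq)
        linarith
      have h1 : (ε / 2) ^ 2 / (5 / 2) ≤ (ε / 2) ^ 2 / (2 * (q * (1 - q) + ε / 2)) :=
        div_le_div_of_nonneg_left (sq_nonneg _) hden0 hden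
      have h2 := mul_le_mul_of_nonneg_left h1 hN'.le
      have h3 : (2 : ℝ) ≤ N * ((ε / 2) ^ 2 / (5 / 2)) := by linarith
      calc _ ≤ Real.exp (-2) := by rw [Real.exp_le_exp]; linarith
        _ ≤ 1 / 4 := by
            rw [Real.exp_neg, one_div]
            refine inv_anti₀ (by norm_num) ?_
            have : Real.exp 2 = Real.exp 1 ^ 2 := by rw [← Real.exp_nat_mul]; norm_num
            rw [this]
            nlinarith [Real.exp_one_gt_d9]
  · have : prob (prodW w (Fin N)) (fun x => ε / 2 ≤ (∑ i, φ (x i)) / N - expect w φ) = 0 := by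
      refine Finset.sum_eq_zero fun x _ => if_neg fun hx => hq ?_
      have h1 : (∑ i, φ (x i)) / N ≤ 1 := by
        rw [div_le_one hN']
        calc ∑ i, φ (x i) ≤ ∑ _i : Fin N, (1 : ℝ) :=
              Finset.sum_le_sum fun i _ => by rcases hφ (x i) with h | h <;> simp [h]
          _ = N := by simp
      linarith
    rw [this]
    norm_num

theorem prob_mean_le (hw : IsDist w) {φ : Z → ℝ} (hφ : ∀ z, φ z = 0 ∨ φ z = 1) (hN : 0 < N)
    {ε : ℝ} (hε : 0 < ε) (hNε : 20 ≤ N * ε ^ 2) :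
    prob (prodW w (Fin N)) (fun x => ε / 2 ≤ |(∑ i, φ (x i)) / N - expect w φ|) ≤ 1 / 2 := by
  have h1 := prob_mean_upper_le hw hφ hN hε hNε
  have h2 := prob_mean_upper_le hw (φ := fun z => 1 - φ z)
    (fun z => by rcases hφ z with h | h <;> simp [h]) hN hε hNε
  have hN' : (N : ℝ) ≠ 0 := by exact_mod_cast hN.ne'
  have e : ∀ x : Fin N → Z, (∑ i, (1 - φ (x i))) / (N : ℝ) = 1 - (∑ i, φ (x i)) / N := by
    intro x
    rw [Finset.sum_sub_distrib]
    simp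
    field_simp
  simp only [e, expect_one_sub hw] at h2
  refine (prob_mono (hw.prodW (Fin N)) fun x _ hx => ?_).trans
    ((prob_or_le (hw.prodW (Fin N)) _ _).trans ((add_le_add h1 h2).trans (by norm_num)))
  rcases le_abs.1 hx with h | h
  · exact Or.inl h
  · right
    linarith

/-- Averaging over exchanges of the members of the pairs. -/
theorem sum_pairs_le (hw : IsDist w) (D : (Fin N → Z) × (Fin N → Z) → Prop) {b : ℝ}
    (hD : ∀ P, prob (prodW coin (Fin N)) (fun σ => D (swapPairs σ P)) ≤ b) :
    ∑ P : (Fin N → Z) × (Fin N → Z),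
      (if D P then prodW w (Fin N) P.1 * prodW w (Fin N) P.2 else 0) ≤ b := by
  set WW : (Fin N → Z) × (Fin N → Z) → ℝ :=
    fun P => prodW w (Fin N) P.1 * prodW w (Fin N) P.2 with hWW
  have hWW0 : ∀ P, 0 ≤ WW P := fun P =>
    mul_nonneg ((hw.prodW (Fin N)).nonneg _) ((hw.prodW (Fin N)).nonneg _)
  have hWW1 : ∑ P, WW P = 1 := by
    rw [hWW, Fintype.sum_prod_type]
    simp only [← Finset.mul_sum, (hw.prodW (Fin N)).sum_eq_one, mul_one]
  have hswap : ∀ σ : Fin N → Bool, ∑ P, (if D (swapPairs σ P) then WW P else 0) =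
      ∑ P, if D P then WW P else 0 := by
    intro σ
    rw [← Equiv.sum_comp (swapPairs_involutive (Z := Z) σ).toPerm fun P => if D P then WW P else 0]
    refine Finset.sum_congr rfl fun P _ => ?_
    simp only [Function.Involutive.coe_toPerm]
    have : WW (swapPairs σ P) = WW P := prodW_swapPairs w σ P
    by_cases h : D (swapPairs σ P) <;> simp [h, this]
  calc ∑ P, (if D P then WW P else 0)
      = ∑ σ : Fin N → Bool, prodW coin (Fin N) σ *
          ∑ P, (if D (swapPairs σ P) then WW P else 0) := by
        simp only [hswap]
        rw [← Finset.sum_mul, (isDist_coin.prodW (Fin N)).sum_eq_one, one_mul]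
    _ = ∑ P, WW P * prob (prodW coin (Fin N)) (fun σ => D (swapPairs σ P)) := by
        simp only [Finset.mul_sum, prob]
        rw [Finset.sum_comm]
        refine Finset.sum_congr rfl fun P _ => Finset.sum_congr rfl fun σ _ => ?_
        split_ifs
        · ring
        · simp
    _ ≤ ∑ P, WW P * b := Finset.sum_le_sum fun P _ => mul_le_mul_of_nonneg_left (hD P) (hWW0 P)
    _ = b := by rw [← Finset.sum_mul, hWW1, one_mul]

/-- Uniform convergence of empirical means over a family of bounded VC dimension, at the optimal
rate. -/
theorem uniform_convergence [DecidableEq Z] (hw : IsDist w) {F : Finset (Finset Z)} {d : ℕ}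
    (hd : 1 ≤ d) (hF : F.vcDim ≤ d) (hN : 0 < N) {ε l : ℝ} (hε : 0 < ε) (hl : 0 ≤ l)
    (hNε : 24576 * (d + l) ≤ N * ε ^ 2) :
    prob (prodW w (Fin N)) (fun x => ∃ f ∈ F,
      ε ≤ |(∑ i, ind f (x i)) / N - expect w (ind f)|) ≤ Real.exp (-l) / 4 := by
  have hN' : (0 : ℝ) < N := by exact_mod_cast hN
  have hd' : (1 : ℝ) ≤ d := by exact_mod_cast hd
  have hWd := hw.prodW (Fin N)
  obtain ⟨D, hD⟩ : ∃ D : (Fin N → Z) × (Fin N → Z) → Prop, ∀ P, D P ↔ ∃ f ∈ F,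
    N * (ε / 2) ≤ |∑ i, ind f (P.1 i) - ∑ i, ind f (P.2 i)| := ⟨_, fun _ => Iff.rfl⟩
  have hsym : ∀ P, prob (prodW coin (Fin N)) (fun σ => D (swapPairs σ P)) ≤
      Real.exp (-l) / 8 := by
    intro P
    set y : Fin N × Bool → Z := fun ib => if ib.2 then P.1 ib.1 else P.2 ib.1 with hy
    refine le_trans (prob_mono (isDist_coin.prodW (Fin N)) fun σ _ hσ => ?_)
      (chaining hd ((vcDim_image_pull_le y F).trans hF) hN hε hl hNε)
    obtain ⟨f, hf, h⟩ := (hD _).1 hσ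
    refine ⟨pull y f, Finset.mem_image_of_mem _ hf, ?_⟩
    have e : ∑ i, coinSign (σ i) * pairDiff (pull y f) i =
        ∑ i, ind f ((swapPairs σ P).1 i) - ∑ i, ind f ((swapPairs σ P).2 i) := by
      rw [← Finset.sum_sub_distrib]
      refine Finset.sum_congr rfl fun i _ => ?_
      have h1 : ∀ b, ind (pull y f) (i, b) = ind f (y (i, b)) := fun b => by
        by_cases h : y (i, b) ∈ f <;> simp [ind, mem_pull, h]
      rw [pairDiff, h1, h1]
      simp only [swapPairs, coinSign, hy]
      cases σ i <;> simp
    rw [e]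
    exact h
  have hbad : ∀ x : Fin N → Z, (∃ f ∈ F, ε ≤ |(∑ i, ind f (x i)) / N - expect w (ind f)|) →
      1 ≤ 2 * prob (prodW w (Fin N)) (fun x' => D (x, x')) := by
    rintro x ⟨f, hf, hx⟩
    have h1 := prob_mean_le hw (ind_eq f) hN hε (by nlinarith : 20 ≤ N * ε ^ 2)
    have h2 := prob_not hWd (fun x' => ε / 2 ≤ |(∑ i, ind f (x' i)) / N - expect w (ind f)|)
    have h3 := prob_mono hWd (E := fun x' => ¬ ε / 2 ≤ |(∑ i, ind f (x' i)) / N - expect w (ind f)|)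
      (F := fun x' => D (x, x')) fun x' _ hx' => by
        refine (hD _).2 ⟨f, hf, ?_⟩
        rw [not_le] at hx'
        have h4 : ε / 2 ≤ |(∑ i, ind f (x i)) / N - (∑ i, ind f (x' i)) / N| := by
          have := abs_sub_le ((∑ i, ind f (x i)) / (N : ℝ)) ((∑ i, ind f (x' i)) / N)
            (expect w (ind f))
          linarith
        rw [← sub_div, abs_div, abs_of_pos hN', le_div_iff₀ hN'] at h4
        linarith
    linarith
  calc prob (prodW w (Fin N)) (fun x => ∃ f ∈ F,
        ε ≤ |(∑ i, ind f (x i)) / N - expect w (ind f)|)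
      ≤ ∑ x, prodW w (Fin N) x * (2 * prob (prodW w (Fin N)) (fun x' => D (x, x'))) :=
        prob_le_sum hWd (fun x => mul_nonneg (by norm_num) (prob_nonneg hWd _)) hbad
    _ = 2 * ∑ P : (Fin N → Z) × (Fin N → Z),
          (if D P then prodW w (Fin N) P.1 * prodW w (Fin N) P.2 else 0) := by
        rw [Fintype.sum_prod_type, Finset.mul_sum]
        refine Finset.sum_congr rfl fun x _ => ?_
        rw [prob, mul_left_comm, Finset.mul_sum]
        congr 1
        exact Finset.sum_congr rfl fun x' _ => by rw [mul_ite, mul_zero]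
    _ ≤ 2 * (Real.exp (-l) / 8) := by
        have := sum_pairs_le hw D hsym
        linarith
    _ = _ := by ring

end Uniform

/-! ### The adaptive loop -/

section Loop

theorem min_mul_min (a N M : ℕ) (ha : 1 ≤ a) : min (a * min (2 * N) M) M = min (a * 2 * N) M := by
  rcases le_total (2 * N) M with h | h
  · rw [min_eq_left h, mul_assoc]
  · rw [min_eq_right h, min_eq_right (Nat.le_mul_of_pos_left M ha), min_eq_right]
    rw [mul_assoc]
    exact h.trans (Nat.le_mul_of_pos_left _ ha)

/-- The loop ends after a successful test, or with the size after all rounds. -/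
theorem finalSize_cases (halt : ℕ → Prop) (M k N : ℕ) (hN : N ≤ M) :
    (∃ i < k, halt (min (2 ^ i * N) M) ∧ finalSize halt M k N = min (2 ^ i * N) M) ∨
      finalSize halt M k N = min (2 ^ k * N) M := by
  induction k generalizing N with
  | zero => right; simp [finalSize, hN]
  | succ k ih =>
    rw [finalSize]
    split_ifs with h
    · left
      have e : min (2 ^ 0 * N) M = N := by simp [hN]
      exact ⟨0, by omega, by rwa [e], e.symm⟩
    · rcases ih (min (2 * N) M) (min_le_right _ _) with ⟨i, hi, h1, h2⟩ | h2
      · rw [min_mul_min _ _ _ Nat.one_le_two_pow, ← pow_succ] at h1 h2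
        exact Or.inl ⟨i + 1, by omega, h1, h2⟩
      · rw [min_mul_min _ _ _ Nat.one_le_two_pow, ← pow_succ] at h2
        exact Or.inr h2

variable {c ε' δ : ℝ} {d : ℕ}

theorem log_one_div_pos (hδ : 0 < δ) (hδ1 : δ < 1) : 0 < Real.log (1 / δ) :=
  Real.log_pos ((one_lt_div hδ).2 hδ1)

theorem initBudget_pos (hc : 0 < c) (hε : 0 < ε') (hδ : 0 < δ) (hδ1 : δ < 1) :
    0 < initBudget c ε' δ :=
  mul_pos (by positivity) (log_one_div_pos hδ hδ1)

theorem initBudget_lt_maxBudget (hc : 0 < c) (hε : 0 < ε') (hd : 1 ≤ d) :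
    initBudget c ε' δ < maxBudget c ε' δ d := by
  have hd' : (1 : ℝ) ≤ d := by exact_mod_cast hd
  unfold initBudget maxBudget
  have : 0 < c / ε' ^ 2 := by positivity
  nlinarith

theorem rounds_pos (hc : 0 < c) (hε : 0 < ε') (hδ : 0 < δ) (hδ1 : δ < 1) (hd : 1 ≤ d) :
    0 < rounds c ε' δ d :=
  Nat.ceil_pos.2 (Real.logb_pos one_lt_two
    ((one_lt_div (initBudget_pos hc hε hδ hδ1)).2 (initBudget_lt_maxBudget hc hε hd)))

theorem maxSize_le (hc : 0 < c) (hε : 0 < ε') (hδ : 0 < δ) (hδ1 : δ < 1) (hd : 1 ≤ d) :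
    maxSize c ε' δ d ≤ 2 ^ rounds c ε' δ d * initSize c ε' δ := by
  have hi := initBudget_pos hc hε hδ hδ1
  have hm := hi.trans (initBudget_lt_maxBudget (δ := δ) hc hε hd)
  have h1 : Real.logb 2 (maxBudget c ε' δ d / initBudget c ε' δ) ≤ rounds c ε' δ d :=
    Nat.le_ceil _
  rw [Real.logb_le_iff_le_rpow one_lt_two (div_pos hm hi), Real.rpow_natCast, div_le_iff₀ hi] at h1
  refine Nat.ceil_le.2 (h1.trans ?_)
  push_cast
  gcongr
  exact Nat.le_ceil _

theorem frameworkSize_cases {ι X : Type*} (loss : ι → X → ℝ) (hc : 0 < c) (hε : 0 < ε')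
    (hδ : 0 < δ) (hδ1 : δ < 1) (hd : 1 ≤ d) (δs : ι → ℝ) (x : ℕ → X) :
    (∃ k < rounds c ε' δ d,
      frameworkSize loss c ε' δ d δs x =
        min (2 ^ k * initSize c ε' δ) (maxSize c ε' δ d) ∧
      ∀ i, bernsteinError (min (2 ^ k * initSize c ε' δ) (maxSize c ε' δ d)) (δs i)
        (sampleVar (min (2 ^ k * initSize c ε' δ) (maxSize c ε' δ d))
          fun j => loss i (x j)) ≤ ε') ∨
      frameworkSize loss c ε' δ d δs x = maxSize c ε' δ d := by
  rcases finalSize_cases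
    (fun N => ∀ i, bernsteinError N (δs i) (sampleVar N fun j => loss i (x j)) ≤ ε')
    (maxSize c ε' δ d) (rounds c ε' δ d) (initSize c ε' δ)
    (Nat.ceil_mono (initBudget_lt_maxBudget hc hε hd).le) with ⟨k, hk, h1, h2⟩ | h
  · exact Or.inl ⟨k, hk, h2, h1⟩
  · right
    rw [min_eq_right (maxSize_le hc hε hδ hδ1 hd)] at h
    exact h

end Loop

/-! ### From independent random variables to finite products -/

section Transfer

open MeasureTheory ProbabilityTheory

variable {Z Ω : Type*} [Fintype Z] [MeasurableSpace Z] [MeasurableSingletonClass Z]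
  [MeasurableSpace Ω] {P : Measure Ω} [IsProbabilityMeasure P] {X : ℕ → Ω → Z} {w : Z → ℝ}

/-- The joint law of the pilot samples and the samples that follow. -/
theorem real_pilot_and (hX : ∀ j, Measurable (X j)) (hind : iIndepFun X P)
    (hlaw : ∀ j z, P.real (X j ⁻¹' {z}) = w z) {m N : ℕ} (y : Fin m → Z)
    (E : (Fin N → Z) → Prop) :
    P.real {ω | (∀ j : Fin m, X j ω = y j) ∧ E fun i : Fin N => X (m + i) ω} =
      prodW w (Fin m) y * prob (prodW w (Fin N)) E := by
  set idx : Fin m ⊕ Fin N → ℕ := Sum.elim (fun j => j) (fun i => m + i) with hidx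
  have hinj : Function.Injective idx := by
    rintro (a | a) (b | b) h <;> simp only [hidx, Sum.elim_inl, Sum.elim_inr] at h
    · rw [Fin.ext h]
    · omega
    · omega
    · rw [Fin.ext (by omega : (a : ℕ) = b)]
  have hind' : iIndepFun (fun i => X (idx i)) P := hind.precomp hinj
  set S : (Fin N → Z) → Set Ω := fun x => ⋂ i ∈ (Finset.univ : Finset (Fin m ⊕ Fin N)),
    X (idx i) ⁻¹' {Sum.elim y x i} with hS
  have hSmem : ∀ x ω, ω ∈ S x ↔ (∀ j : Fin m, X j ω = y j) ∧ ∀ i : Fin N, X (m + i) ω = x i := by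
    intro x ω
    simp [hS, hidx]
  have hSmeas : ∀ x, MeasurableSet (S x) := fun x =>
    Finset.measurableSet_biInter _ fun i _ => hX _ (measurableSet_singleton _)
  have hSreal : ∀ x, P.real (S x) = prodW w (Fin m) y * prodW w (Fin N) x := by
    intro x
    have h := hind'.measure_inter_preimage_eq_mul Finset.univ
      (sets := fun i => {Sum.elim y x i}) fun i _ => measurableSet_singleton _
    rw [Measure.real, hS, h, ENNReal.toReal_prod, Fintype.prod_sum_type]
    simp only [prodW]
    congr 1
    · exact Finset.prod_congr rfl fun j _ => hlaw _ _
    · exact Finset.prod_congr rfl fun i _ => hlaw _ _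
  have hunion : {ω | (∀ j : Fin m, X j ω = y j) ∧ E fun i : Fin N => X (m + i) ω} =
      ⋃ x ∈ Finset.univ.filter E, S x := by
    ext ω
    simp only [Set.mem_ofPred_eq, Set.mem_iUnion, Finset.mem_filter, Finset.mem_univ, true_and,
      hSmem, exists_prop]
    constructor
    · rintro ⟨h1, h2⟩
      exact ⟨_, h2, h1, fun _ => rfl⟩
    · rintro ⟨x, hx, h1, h2⟩
      refine ⟨h1, ?_⟩
      rwa [funext h2]
  rw [hunion, measureReal_biUnion_finset _ fun x _ => hSmeas x]
  · rw [prob, Finset.sum_filter, Finset.mul_sum]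
    refine Finset.sum_congr rfl fun x _ => ?_
    rw [hSreal]
    split_ifs <;> simp
  · intro x _ x' _ hne
    refine Set.disjoint_left.2 fun ω h h' => hne ?_
    ext i
    rw [← ((hSmem x ω).1 h).2 i, ((hSmem x' ω).1 h').2 i]

/-- Correctness of the adaptive sampling framework for 0-1 losses, given uniform convergence at the
maximum sample size. -/
theorem framework_error {ι : Type*} [Fintype ι] (hw : IsDist w) {loss : ι → Z → ℝ}
    (hloss : ∀ i z, loss i z = 0 ∨ loss i z = 1) {c ε' δ : ℝ} {d : ℕ} (hc : 0 < c) (hε : 0 < ε')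
    (hδ : 0 < δ) (hδ1 : δ < 1) (hd : 1 ≤ d)
    (huc : prob (prodW w (Fin (maxSize c ε' δ d))) (fun x => ∃ i,
      ε' ≤ |(∑ j, loss i (x j)) / maxSize c ε' δ d - expect w (loss i)|) ≤ δ / 4)
    {m : ℕ} {alloc : (Fin m → Z) → ι → ℝ} (halloc : IsErrorAllocation alloc c ε' δ d)
    (hX : ∀ j, Measurable (X j)) (hind : iIndepFun X P)
    (hlaw : ∀ j z, P.real (X j ⁻¹' {z}) = w z) :
    P.real {ω | ∃ i, ∃ N, N = frameworkSize loss c ε' δ d (alloc fun j => X j ω)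
        (fun j => X (m + j) ω) ∧
      ε' ≤ |(∑ j ∈ Finset.range N, loss i (X (m + j) ω)) / N - expect w (loss i)|} ≤ δ := by
  set M := maxSize c ε' δ d with hM
  set K := rounds c ε' δ d with hK
  set n : ℕ → ℕ := fun k => min (2 ^ k * initSize c ε' δ) M with hn
  have hK0 : (0 : ℝ) < K := by exact_mod_cast rounds_pos hc hε hδ hδ1 hd
  have hK1 : (1 : ℝ) ≤ K := by exact_mod_cast rounds_pos hc hε hδ hδ1 hd
  have hn0 : ∀ k, 0 < n k := fun k => by
    have h1 : 0 < initSize c ε' δ := Nat.ceil_pos.2 (initBudget_pos hc hε hδ hδ1)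
    have h2 : 0 < M := Nat.ceil_pos.2
      ((initBudget_pos hc hε hδ hδ1).trans (initBudget_lt_maxBudget hc hε hd))
    exact lt_min (by positivity) h2
  have hL : ∀ y i, 0 < Real.log (2 / alloc y i) := by
    intro y i
    obtain ⟨hpos, hsum⟩ := halloc y
    have h1 : 2 * alloc y i ≤ δ / K := by
      rw [← hsum]
      exact Finset.single_le_sum (f := fun i => 2 * alloc y i)
        (fun j _ => by have := hpos j; positivity) (Finset.mem_univ i)
    have h2 : δ / K ≤ δ := div_le_self hδ.le hK1
    exact Real.log_pos ((one_lt_div (hpos i)).2 (by linarith))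
  set test : (Fin m → Z) → ι → ∀ k, (Fin (n k) → Z) → Prop := fun y i k x =>
    meanError (n k) (Real.log (2 / alloc y i)) ((∑ j, loss i (x j)) / n k) ≤
      |(∑ j, loss i (x j)) / n k - expect w (loss i)| with htest
  set unif : (Fin M → Z) → Prop := fun x => ∃ i,
    ε' ≤ |(∑ j, loss i (x j)) / M - expect w (loss i)| with hunif
  set pil : (Fin m → Z) → Ω → Prop := fun y ω => ∀ j : Fin m, X j ω = y j with hpil
  set bad : (Fin m → Z) → Set Ω := fun y =>
    (⋃ k ∈ Finset.range K, ⋃ i ∈ (Finset.univ : Finset ι),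
      {ω | pil y ω ∧ test y i k fun j => X (m + j) ω}) ∪
    {ω | pil y ω ∧ unif fun j => X (m + j) ω} with hbad
  have hsub : {ω | ∃ i, ∃ N, N = frameworkSize loss c ε' δ d (alloc fun j => X j ω)
        (fun j => X (m + j) ω) ∧
      ε' ≤ |(∑ j ∈ Finset.range N, loss i (X (m + j) ω)) / N - expect w (loss i)|} ⊆
      ⋃ y ∈ (Finset.univ : Finset (Fin m → Z)), bad y := by
    rintro ω ⟨i, N, hN, h⟩
    set y : Fin m → Z := fun j => X j ω with hy
    refine Set.mem_biUnion (x := y) (by simp) ?_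
    rcases frameworkSize_cases loss hc hε hδ hδ1 hd (alloc y) (fun j => X (m + j) ω) with
      ⟨k, hk, hNk, ht⟩ | hNM
    · left
      refine Set.mem_biUnion (x := k) (by simpa using hk)
        (Set.mem_biUnion (x := i) (by simp) ⟨fun _ => rfl, ?_⟩)
      have hN' : N = n k := hN.trans hNk
      rw [hN', Finset.sum_range] at h
      have h1 := meanError_le_bernsteinError (z := fun j => loss i (X (m + j) ω))
        (fun j => hloss i _) (n k) (hL y i).le
      rw [Finset.sum_range] at h1
      exact h1.trans ((ht i).trans h)
    · right
      refine ⟨fun _ => rfl, i, ?_⟩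
      have hN' : N = M := hN.trans hNM
      rwa [hN', Finset.sum_range] at h
  have hbadle : ∀ y, P.real (bad y) ≤ prodW w (Fin m) y * δ := by
    intro y
    have hW0 := (hw.prodW (Fin m)).nonneg y
    have h1 : ∀ k i, P.real {ω | pil y ω ∧ test y i k fun j => X (m + j) ω} ≤
        prodW w (Fin m) y * alloc y i := by
      intro k i
      rw [real_pilot_and hX hind hlaw y (test y i k)]
      refine mul_le_mul_of_nonneg_left ?_ hW0
      refine (prob_meanError hw (hloss i) (hn0 k) (hL y i)).trans (le_of_eq ?_)
      have hp := (halloc y).1 i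
      rw [Real.exp_neg, Real.exp_log (by positivity)]
      field_simp
    have h2 : P.real {ω | pil y ω ∧ unif fun j => X (m + j) ω} ≤
        prodW w (Fin m) y * (δ / 4) := by
      rw [real_pilot_and hX hind hlaw y unif]
      exact mul_le_mul_of_nonneg_left huc hW0
    have hsum : ∑ i, alloc y i = δ / K / 2 := by
      rw [← (halloc y).2, ← Finset.mul_sum]
      ring
    calc P.real (bad y) ≤ (∑ k ∈ Finset.range K, ∑ i, prodW w (Fin m) y * alloc y i) +
          prodW w (Fin m) y * (δ / 4) := by
          refine (measureReal_union_le _ _).trans (add_le_add ?_ h2)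
          refine (measureReal_biUnion_finset_le _ _).trans (Finset.sum_le_sum fun k _ => ?_)
          exact (measureReal_biUnion_finset_le _ _).trans (Finset.sum_le_sum fun i _ => h1 k i)
      _ = prodW w (Fin m) y * (δ / 2 + δ / 4) := by
          rw [← Finset.mul_sum, hsum, Finset.sum_const, Finset.card_range, nsmul_eq_mul]
          field_simp
      _ ≤ _ := mul_le_mul_of_nonneg_left (by linarith) hW0
  calc _ ≤ P.real (⋃ y ∈ (Finset.univ : Finset (Fin m → Z)), bad y) :=
        measureReal_mono hsub (measure_ne_top _ _)
    _ ≤ ∑ y, P.real (bad y) := measureReal_biUnion_finset_le _ _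
    _ ≤ ∑ y, prodW w (Fin m) y * δ := Finset.sum_le_sum fun y _ => hbadle y
    _ = δ := by rw [← Finset.sum_mul, (hw.prodW (Fin m)).sum_eq_one, one_mul]

end Transfer

/-! ### Correctness of the estimates -/

section Correctness

open MeasureTheory ProbabilityTheory

variable {V : Type*} {G : SimpleGraph V} {A : Finset V}

theorem g_eq (v : V) (p : ShortestPath G) : g v p = 0 ∨ g v p = 1 := by
  unfold g
  split_ifs <;> simp

variable [Fintype V]

theorem isDist_genProb (hG : G.Connected) (hV : 2 ≤ Fintype.card V) (hA : A.Nonempty) :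
    IsDist (genProb G A) :=
  ⟨genProb_nonneg hG hV hA, sum_genProb hG hV hA⟩

/-- Uniform convergence for the hypotheses of the target nodes. -/
theorem prob_uniform_g (hG : G.Connected) (hV : 2 ≤ Fintype.card V) (hA : A.Nonempty) {d N : ℕ}
    (hd : 1 ≤ d) (hVC : VCBound G A d) (hN : 0 < N) {ε l : ℝ} (hε : 0 < ε) (hl : 0 ≤ l)
    (hNε : 24576 * (d + l) ≤ N * ε ^ 2) :
    prob (prodW (genProb G A) (Fin N)) (fun x => ∃ v : A,
      ε ≤ |(∑ j, g (v : V) (x j)) / N - expect (genProb G A) (g (v : V))|) ≤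
        Real.exp (-l) / 4 := by
  have hw := isDist_genProb hG hV hA
  refine le_trans (prob_mono (hw.prodW (Fin N)) fun x hx => ?_)
    (uniform_convergence hw hd hVC hN hε hl hNε)
  rintro ⟨v, hv⟩
  refine ⟨_, Finset.mem_image_of_mem _ v.2, ?_⟩
  have hgen : ∀ p, genProb G A p ≠ 0 →
      ind ((approxSpace G A).filter fun p => IsInner (v : V) p) p = g (v : V) p := by
    intro p hp
    have hpa : p ∈ approxSpace G A := by
      by_contra h
      exact hp (genProb_eq_zero hG hV hA h)
    by_cases h : IsInner (v : V) p <;> simp [ind, g, hpa, h]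
  have h1 : expect (genProb G A) (ind ((approxSpace G A).filter fun p => IsInner (v : V) p)) =
      expect (genProb G A) (g (v : V)) := by
    refine Finset.sum_congr rfl fun p _ => ?_
    by_cases hp : genProb G A p = 0
    · simp [hp]
    · rw [hgen p hp]
  have h2 : ∀ j, ind ((approxSpace G A).filter fun p => IsInner (v : V) p) (x j) =
      g (v : V) (x j) := fun j => hgen _ (Finset.prod_ne_zero_iff.1 hx j (Finset.mem_univ j))
  rw [h1]
  simp only [h2]
  exact hv

theorem estimate_sub_bc (hG : G.Connected) (hV : 2 ≤ Fintype.card V) (c ε δ : ℝ) (d : ℕ)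
    (alloc : (Fin (pilotSize G A c ε δ) → ShortestPath G) → A → ℝ) (x : ℕ → ShortestPath G)
    (v : A) {N : ℕ} (hN : N = frameworkSize (fun (u : A) (p : ShortestPath G) => g (u : V) p) c
      (epsPrime G A ε) δ d (alloc fun j => x j) (fun j => x (pilotSize G A c ε δ + j))) :
    estimate G A c ε δ d alloc x v - bc G v =
      gamma G * eta G A * (1 - exactWeight G A) *
        ((∑ j ∈ Finset.range N, g (v : V) (x (pilotSize G A c ε δ + j))) / N -
          expect (genProb G A) (g (v : V))) := by
  have h : estimate G A c ε δ d alloc x v = bcA G v + gamma G * eta G A *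
      (exactRisk G A v + (1 - exactWeight G A) *
        (1 / (N : ℝ) * ∑ j ∈ Finset.range N, g (v : V) (x (pilotSize G A c ε δ + j)))) := by
    rw [hN]
    rfl
  rw [h, bc_eq_risk hG hV v.2, expect]
  ring

end Correctness

end
end SaPHyRa

open SaPHyRa MeasureTheory ProbabilityTheory in
theorem mainTheorem1 :
    ∃ c₀ : ℝ, 0 < c₀ ∧ ∀ c : ℝ, c₀ ≤ c →
      ∀ (V : Type*) [Fintype V] (G : SimpleGraph V) (A : Finset V) (ε δ : ℝ) (d : ℕ),
        G.Connected → 2 ≤ Fintype.card V → A.Nonempty →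
        0 < ε → ε < 1 → 0 < δ → δ < 1 →
        1 ≤ d → VCBound G A d →
        (∀ p, 0 ≤ genProb G A p) ∧ ∑ p, genProb G A p = 1 ∧
        ∀ alloc : (Fin (pilotSize G A c ε δ) → ShortestPath G) → A → ℝ,
          IsErrorAllocation alloc c (epsPrime G A ε) δ d →
          ∀ (Ω : Type*) [MeasurableSpace Ω] (P : Measure Ω) [IsProbabilityMeasure P]
            (X : ℕ → Ω → ShortestPath G),
            (∀ j, Measurable (X j)) → iIndepFun X P →
            (∀ j p, P.real (X j ⁻¹' {p}) = genProb G A p) →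
            1 - δ ≤ P.real {ω | ∀ v : A,
              |estimate G A c ε δ d alloc (fun j => X j ω) v - bc G v| < ε} := by
  refine ⟨24576, by norm_num, fun c hc V _ G A ε δ d hG hV hA hε _ hδ hδ1 hd hVC =>
    ⟨genProb_nonneg hG hV hA, sum_genProb hG hV hA, fun alloc halloc Ω _ P _ X hX hind hlaw => ?_⟩⟩
  have hc0 : 0 < c := by linarith
  have hk := gamma_mul_eta_pos hG hV hA
  have hlam := one_sub_exactWeight_pos hG hV hA
  have hε' : 0 < epsPrime G A ε := div_pos (div_pos hε hk) hlam
  have hl := log_one_div_pos hδ hδ1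
  have hM0 : 0 < maxSize c (epsPrime G A ε) δ d := Nat.ceil_pos.2
    ((initBudget_pos hc0 hε' hδ hδ1).trans (initBudget_lt_maxBudget hc0 hε' hd))
  have hMε : 24576 * (d + Real.log (1 / δ)) ≤
      maxSize c (epsPrime G A ε) δ d * epsPrime G A ε ^ 2 := by
    have h1 : maxBudget c (epsPrime G A ε) δ d ≤ maxSize c (epsPrime G A ε) δ d := Nat.le_ceil _
    have h2 : maxBudget c (epsPrime G A ε) δ d * epsPrime G A ε ^ 2 =
        c * (d + Real.log (1 / δ)) := by
      rw [maxBudget]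
      field_simp
    calc _ ≤ c * (d + Real.log (1 / δ)) := by gcongr
      _ = _ := h2.symm
      _ ≤ _ := by gcongr
  have huc := prob_uniform_g hG hV hA hd hVC hM0 hε' hl.le hMε
  rw [Real.log_div one_ne_zero hδ.ne', Real.log_one, zero_sub, neg_neg, Real.exp_log hδ] at huc
  have hbad := framework_error (isDist_genProb hG hV hA)
    (loss := fun (u : A) (p : ShortestPath G) => g (u : V) p) (fun u p => g_eq _ p)
    hc0 hε' hδ hδ1 hd huc halloc hX hind hlaw
  set good : Set Ω := {ω | ∀ v : A,
    |estimate G A c ε δ d alloc (fun j => X j ω) v - bc G v| < ε} with hgood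
  have hcompl : P.real goodᶜ ≤ δ := by
    refine le_trans (measureReal_mono fun ω hω => ?_) hbad
    simp only [hgood, Set.mem_compl_iff, Set.mem_ofPred_eq, not_forall, not_lt] at hω
    obtain ⟨v, hv⟩ := hω
    refine ⟨v, _, rfl, ?_⟩
    rw [estimate_sub_bc hG hV c ε δ d alloc (fun j => X j ω) v rfl, abs_mul,
      abs_of_pos (mul_pos hk hlam)] at hv
    exact le_of_eq_of_le (div_div _ _ _) ((div_le_iff₀' (mul_pos hk hlam)).2 hv)
  have huniv : (1 : ℝ) ≤ P.real good + P.real goodᶜ := by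
    rw [← probReal_univ (μ := P), ← Set.union_compl_self good]
    exact measureReal_union_le _ _
  linarith
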